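/- Let $(W,S)$ be an arbitrary Coxeter system with $S$ finite ($W$ possibly infinite), with Coxeter diagram $\Gamma$ (a graph on $S$, with $s\ne s'$ joined when $m(s,s')\ge 3$ or $m(s,s')=\infty$). Let $\Phi=\{w\alpha_s\}$ be its root system in the geometric representation $V=\mathbb{R}^S$ with basis the simple roots $\alpha_s$, let $\Phi^+$ be the set of positive roots, and let $M_\Phi$ be the (oriented) matroid of the vector configuration $\Phi^+$. For a flat $F$ of $M_\Phi$ let $X_F=\{f\in V^*: f|_F=0\}$, and let $T=\bigcup_{w\in W} w(R)\subset V^*$ be the Tits cone, where $R=\{f: f(\alpha_s)\ge 0 \text{ for all } s\}$. A flat $F$ is *parabolic* if $\dim(X_F\cap T)=\dim X_F$ (every flat is, if $W$ is finite), and *positive* if it is a parabolic flat of the form $\{\alpha\in\Phi^+: f(\alpha)=0\}$ for some $f\in V^*$ that is nonnegative on $\Phi^+$. To a flag $\mathcal F$: $\emptyset=F_0\subset F_1\subset\dots\subset F_k\subset F_{k+1}=\Phi^+$ of positive flats (all inclusions strict) associate the matroid $M_{\mathcal F}=\bigoplus_{i=1}^{k+1}F_i/F_{i-1}$. The *positive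 Bergman complex* $\mathcal B^+(M_\Phi)$ is the order complex of the poset of positive flats other than $\emptyset$ and $\Phi^+$; its simplices (the empty one included) are the flags of positive flats. The cells of its *coarse subdivision* are the classes of flags with the same matroid $M_{\mathcal F}$; a cell $c$ is a face of a cell $d$ if $c$ lies in the closure of $d$, that is, if every flag in $c$ is contained in a flag in $d$. For a connected graph $G$ on $n$ nodes, a *tube* is a proper nonempty set of nodes inducing a connected subgraph; a *tubing* is a set of tubes any two distinct members of which are either nested, or disjoint with a union that does not induce a connected subgraph. The *graph associahedron* $P(G)$ is a polytope obtained from an $(n-1)$-simplex, whose facets correspond to the nodes, by successively truncating, for all tubes $t$ in increasing order of dimension of the corresponding faces, the face that is the intersection of the facets of the nodes in $t$. For a graph $\Gamma$ with connected components $\Gamma_1,\dots,\Gamma_c$, put $P(\Gamma)=P(\Gamma_1)\times\dots\times P(\Gamma_c)$, and let a tubing of $\Gamma$ be a tuple of tubings of $\Gamma_1,\dots,\Gamma_c$, ordered by componentwise containment. **Theorem.** The polytope $P(\Gamma)$ exists, and, for every choice made in its construction, the face poset of the coarse subdivision of $\mathcal B^+(M_\Phi)$ (with the cell of the empty flag)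 is dual, i.e. anti-isomorphic, to the poset of nonempty faces of $P(\Gamma)$. Moreover it is isomorphic to the poset of tubings of $\Gamma$ ordered by containment. -/

import Mathlib

/-! ### The matroid of a vector configuration, and the matroid of a flag -/

namespace Bergman

open Set

/-- The matroid represented by a set `E` of vectors: ground set `E`, and a subset of `E` is
independent iff it is linearly independent. -/
noncomputable def linearMatroid {V : Type*} [AddCommGroup V] [Module ℝ V] (E : Set V) :
    Matroid V :=
  (IndepMatroid.ofFinitary E (fun I => I ⊆ E ∧ LinearIndepOn ℝ id I)
    ⟨empty_subset _, linearIndepOn_empty ℝ id⟩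
    (fun _ _ hJ hIJ => ⟨hIJ.trans hJ.1, hJ.2.mono hIJ⟩)
    (by
      intro I B hI hImax hB
      by_contra! hcon
      have hBI : B ⊆ Submodule.span ℝ I := by
        intro x hx
        by_contra hxI
        exact hcon x ⟨hx, fun h => hxI (Submodule.subset_span h)⟩
          (insert_subset (hB.prop.1 hx) hI.1) (hI.2.id_insert hxI)
      apply hImax
      refine ⟨hI, fun J hJ hIJ x hx => ?_⟩
      by_contra hxI
      have hxB : x ∈ Submodule.span ℝ B := by
        by_contra hxB
        have h := hB.le_of_ge (y := insert x B)
          ⟨insert_subset (hJ.1 hx) hB.prop.1, hB.prop.2.id_insert hxB⟩ (subset_insert x B)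
        exact hxB (Submodule.subset_span (h (mem_insert x B)))
      have hxs : x ∈ Submodule.span ℝ I := Submodule.span_le.2 hBI hxB
      have h2 : LinearIndepOn ℝ id (insert x I) := hJ.2.mono (insert_subset hx hIJ)
      exact ((linearIndepOn_id_insert hxI).1 h2).2 hxs)
    (by
      intro I h
      refine ⟨fun x hx => (h {x} (by simpa using hx) (finite_singleton x)).1 rfl, ?_⟩
      exact linearIndepOn_of_finite I fun t ht hfin => (h t ht hfin).2)
    (fun _ hI => hI.1)).matroid

/-- For a member `F` of a chain `𝓕` of flats (or `F` the ground set), the union of the members of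
`𝓕` strictly below `F`: the member of `𝓕` immediately preceding `F`, or `∅` if there is none. -/
def pred {α : Type*} (𝓕 : Set (Set α)) (F : Set α) : Set α := ⋃₀ {G ∈ 𝓕 | G ⊂ F}

/-- The matroid `M_𝓕 = ⨁ᵢ Fᵢ / Fᵢ₋₁` of a flag `∅ = F₀ ⊂ F₁ ⊂ ⋯ ⊂ F_k ⊂ F_{k+1} = E` of subsets of
the ground set `E`, given by the chain `𝓕 = {F₁, …, F_k}`. The summands are indexed by
`F ∈ 𝓕 ∪ {E}`; the summand of `F` is the contraction of the preceding member of the flag in the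
restriction of `M` to `F`. -/
noncomputable def flagMatroid {α : Type*} (M : Matroid α) (𝓕 : Set (Set α))
    (hsub : ∀ F ∈ 𝓕, F ⊆ M.E) (hchain : IsChain (· ⊆ ·) 𝓕) : Matroid α :=
  Matroid.disjointSigma
    (fun F : (insert M.E 𝓕 : Set (Set α)) => (M.restrict F.1).contract (pred 𝓕 F.1))
    (by
      have key : ∀ F G : (insert M.E 𝓕 : Set (Set α)), F ≠ G → F.1 ⊆ G.1 →
          F.1 ⊆ pred 𝓕 G.1 := by
        rintro ⟨F, hF⟩ ⟨G, hG⟩ hne hFG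
        have hss : F ⊂ G := LE.le.ssubset_of_ne hFG fun h => hne (Subtype.ext h)
        rcases hF with rfl | hF
        · rcases hG with rfl | hG
          · exact absurd rfl hne
          · exact absurd (hsub G hG) hss.2
        · exact subset_sUnion_of_mem ⟨hF, hss⟩
      intro F G hne
      have htot : F.1 ⊆ G.1 ∨ G.1 ⊆ F.1 := by
        have hc : IsChain (· ⊆ ·) (insert M.E 𝓕) :=
          hchain.insert fun b hb _ => Or.inr (hsub b hb)
        exact hc.total F.2 G.2
      rw [Function.onFun, Set.disjoint_left]
      intro x hxF hxG
      rcases htot with h | h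
      · exact hxG.2 (key F G hne h hxF.1)
      · exact hxF.2 (key G F hne.symm h hxG.1))

end Bergman

/-! ### The geometric representation, roots, and the Tits cone -/

namespace CoxeterMatrix

variable {B : Type*} [Fintype B] [DecidableEq B] (M : CoxeterMatrix B)

/-- The Coxeter diagram (as an unlabelled graph): `i` and `j` are joined iff `m(i, j) ≥ 3` or
`m(i, j) = ∞`, the latter being encoded by the matrix entry `0`. -/
def diagram {B : Type*} (M : CoxeterMatrix B) : SimpleGraph B where
  Adj i j := i ≠ j ∧ (M i j = 0 ∨ 3 ≤ M i j)
  symm := ⟨fun i j h => ⟨h.1.symm, by rw [M.symmetric j i]; exact h.2⟩⟩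
  loopless := ⟨fun _ h => h.1 rfl⟩

/-- The simple root `α_i`, in the space `V = B → ℝ` with basis the simple roots. -/
def simpleRoot (i : B) : B → ℝ := Pi.single i 1

/-- The bilinear form with `(α_i, α_j) = -cos (π / m(i, j))`. For `m(i, j) = ∞`, encoded by `0`, the
convention `π / 0 = 0` gives the right value `-1`. -/
noncomputable def form : LinearMap.BilinForm ℝ (B → ℝ) :=
  Matrix.toBilin' (Matrix.of fun i j => -Real.cos (Real.pi / M i j))

lemma form_simpleRoot (i j : B) :
    M.form (simpleRoot i) (simpleRoot j) = -Real.cos (Real.pi / M i j) := by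
  simp [form, simpleRoot]

lemma two_smul_form_self (i : B) : (2 • M.form.flip (simpleRoot i)) (simpleRoot i) = (2 : ℝ) := by
  simp [form_simpleRoot]

/-- The reflection `v ↦ v - 2 (v, α_i) α_i`. -/
noncomputable def simpleReflection (i : B) : (B → ℝ) ≃ₗ[ℝ] (B → ℝ) :=
  Module.reflection (M.two_smul_form_self i)

lemma simpleReflection_apply (i : B) (v : B → ℝ) :
    M.simpleReflection i v = v - (2 * M.form v (simpleRoot i)) • simpleRoot i := by
  simp [simpleReflection, Module.reflection_apply]

/-- The simple reflections satisfy the Coxeter relations. -/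
lemma isLiftable_simpleReflection : M.IsLiftable M.simpleReflection := by
  intro i j
  by_cases hij : i = j
  · subst hij
    rw [M.diagonal, pow_one]
    ext1 v
    exact Module.involutive_reflection (M.two_smul_form_self i) v
  have hone : M i j ≠ 1 := M.off_diagonal i j hij
  generalize hm : M i j = m at hone
  rcases Nat.eq_zero_or_pos m with rfl | hpos
  · exact pow_zero _
  have hfy : (2 • M.form.flip (simpleRoot i)) (simpleRoot j) = -2 * Real.cos (Real.pi / m) := by
    simp [form_simpleRoot, M.symmetric j i, hm]
  have hgx : (2 • M.form.flip (simpleRoot j)) (simpleRoot i) = -2 * Real.cos (Real.pi / m) := by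
    simp [form_simpleRoot, hm]
  have hm0 : (m : ℝ) ≠ 0 := by positivity
  set θ : ℝ := 2 * (Real.pi / m) with hθ
  have ht : 2 * Real.cos θ = (2 • M.form.flip (simpleRoot i)) (simpleRoot j) *
      (2 • M.form.flip (simpleRoot j)) (simpleRoot i) - 2 := by
    rw [hfy, hgx, hθ, Real.cos_two_mul]; ring
  ext1 v
  rw [simpleReflection, simpleReflection,
    Module.reflection_mul_reflection_pow_apply _ _ m v (2 * Real.cos θ) ht]
  by_cases h2 : m = 2
  · subst h2
    have hc : Real.cos θ = -1 := by
      rw [hθ]; push_cast; rw [mul_div_cancel₀ _ (two_ne_zero)]; exact Real.cos_pi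
    have hz : Real.cos (Real.pi / (2 : ℕ)) = 0 := by push_cast; exact Real.cos_pi_div_two
    rw [hfy, hgx, hz, hc]
    norm_num
    module
  have hθ0 : 0 < θ := by positivity
  have hθπ : θ < Real.pi := by
    have h3 : (3 : ℝ) ≤ m := by exact_mod_cast (by omega : 3 ≤ m)
    rw [hθ, ← mul_div_assoc, div_lt_iff₀ (by positivity)]
    nlinarith [Real.pi_pos]
  have hs : Real.sin θ ≠ 0 := (Real.sin_pos_of_pos_of_lt_pi hθ0 hθπ).ne'
  have hS : ∀ n : ℤ, (Polynomial.Chebyshev.S ℝ n).eval (2 * Real.cos θ) =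
      Real.sin ((n + 1) * θ) / Real.sin θ := fun n => by
    rw [eq_div_iff hs]; exact Polynomial.Chebyshev.S_two_mul_real_cos θ n
  rcases Nat.even_or_odd' m with ⟨k, rfl | rfl⟩
  · have e1 : ((2 * k : ℕ) - 2 : ℤ) / 2 = k - 1 := by omega
    have e2 : ((2 * k : ℕ) - 1 : ℤ) / 2 = k - 1 := by omega
    have h0 : (Polynomial.Chebyshev.S ℝ ((k : ℤ) - 1)).eval (2 * Real.cos θ) = 0 := by
      rw [hS]
      have : (((k : ℤ) - 1 : ℤ) + 1 : ℝ) * θ = Real.pi := by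
        have hk : (k : ℝ) ≠ 0 := by
          rintro h
          simp [h] at hm0
        rw [hθ]; push_cast; field_simp; ring
      rw [this, Real.sin_pi, zero_div]
    rw [e1, e2, h0]
    simp
  · have e1 : ((2 * k + 1 : ℕ) - 1 : ℤ) / 2 = k := by omega
    have e2 : ((2 * k + 1 : ℕ) - 3 : ℤ) / 2 = k - 1 := by omega
    have e3 : ((2 * k + 1 : ℕ) : ℤ) / 2 = k := by omega
    have e4 : ((2 * k + 1 : ℕ) - 2 : ℤ) / 2 = k - 1 := by omega
    have h0 : (Polynomial.Chebyshev.S ℝ (k : ℤ)).eval (2 * Real.cos θ) +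
        (Polynomial.Chebyshev.S ℝ ((k : ℤ) - 1)).eval (2 * Real.cos θ) = 0 := by
      rw [hS, hS, ← add_div]
      have : ((k : ℤ) + 1 : ℝ) * θ = 2 * Real.pi - (((k : ℤ) - 1 : ℤ) + 1 : ℝ) * θ := by
        push_cast at hm0 ⊢
        rw [hθ]; push_cast; field_simp; ring
      rw [this, Real.sin_two_pi_sub, neg_add_cancel, zero_div]
    rw [e1, e2, e3, e4, h0]
    simp

end CoxeterMatrix

namespace CoxeterSystem

open Set CoxeterMatrix

variable {B : Type*} [Fintype B] [DecidableEq B] {M : CoxeterMatrix B} {W : Type*} [Group W]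
  (cs : CoxeterSystem M W)

/-- The geometric representation of `W` on `V = B → ℝ`, in which the simple generator `s_i` acts by
the reflection `v ↦ v - 2 (v, α_i) α_i`. -/
noncomputable def geomRep : W →* ((B → ℝ) ≃ₗ[ℝ] (B → ℝ)) :=
  cs.lift ⟨M.simpleReflection, M.isLiftable_simpleReflection⟩

/-- The root system `Φ = {w α_i}`. -/
def roots : Set (B → ℝ) := {v | ∃ (w : W) (i : B), v = cs.geomRep w (simpleRoot i)}

/-- The positive roots: the roots all of whose coordinates in the simple roots are nonnegative. -/
def posRoots : Set (B → ℝ) := {v ∈ cs.roots | ∀ i, 0 ≤ v i}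

/-- The matroid `M_Φ` of the vector configuration `Φ⁺`. -/
noncomputable def rootMatroid : Matroid (B → ℝ) := Bergman.linearMatroid cs.posRoots

/-- The Tits cone `T = ⋃_w w(R)` in the dual space `V*`, where `R = {f | f(α_i) ≥ 0 for all i}` is
the closed fundamental chamber and `W` acts on `V*` by `w f = f ∘ w⁻¹`. -/
def titsCone : Set (Module.Dual ℝ (B → ℝ)) :=
  {f | ∃ w : W, ∀ i, 0 ≤ f (cs.geomRep w (simpleRoot i))}

/-- A flat `F` of `M_Φ` is parabolic if `X_F ∩ T` has the same dimension as
`X_F = {f ∈ V* | f = 0 on F}`, i.e. if `X_F ∩ T` spans `X_F`. -/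
def IsParabolicFlat (F : Set (B → ℝ)) : Prop :=
  cs.rootMatroid.IsFlat F ∧
    Submodule.span ℝ (((Submodule.span ℝ F).dualAnnihilator : Set (Module.Dual ℝ (B → ℝ))) ∩
      cs.titsCone) = (Submodule.span ℝ F).dualAnnihilator

/-- A positive flat of the oriented matroid `M_Φ`: a (parabolic) flat that is the zero set of a
positive covector. The covectors are the sign vectors on `Φ⁺` of the linear functionals
`f ∈ V*`, and such a covector is positive if `f ≥ 0` on `Φ⁺`. -/
def IsPositiveFlat (F : Set (B → ℝ)) : Prop :=
  cs.IsParabolicFlat F ∧ ∃ f : Module.Dual ℝ (B → ℝ),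
    (∀ a ∈ cs.posRoots, 0 ≤ f a) ∧ F = {a ∈ cs.posRoots | f a = 0}

/-- A flag of positive flats `∅ ⊂ F₁ ⊂ ⋯ ⊂ F_k ⊂ Φ⁺`, recorded as the finite chain
`{F₁, …, F_k}`: a simplex (possibly the empty one) of the order complex of the proper part of
the lattice of positive flats, i.e. a cell of the fine subdivision of the positive Bergman
complex. -/
structure PosFlag where
  carrier : Set (Set (B → ℝ))
  finite : carrier.Finite
  positive : ∀ F ∈ carrier, cs.IsPositiveFlat F
  ne_empty : ∀ F ∈ carrier, F ≠ ∅
  ne_ground : ∀ F ∈ carrier, F ≠ cs.posRoots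
  chain : IsChain (· ⊆ ·) carrier

/-- The matroid `M_𝓕` of a flag of positive flats. -/
noncomputable def PosFlag.matroid {cs : CoxeterSystem M W} (𝓕 : cs.PosFlag) :
    Matroid (B → ℝ) :=
  Bergman.flagMatroid cs.rootMatroid 𝓕.carrier
    (fun F hF => (𝓕.positive F hF).1.1.subset_ground) 𝓕.chain

/-- Two flags are equivalent if they have the same matroid `M_𝓕`. -/
def coarseSetoid : Setoid cs.PosFlag where
  r 𝓕 𝓖 := 𝓕.matroid = 𝓖.matroid
  iseqv := ⟨fun _ => rfl, fun h => h.symm, fun h h' => h.trans h'⟩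

/-- The cells of the coarse subdivision of the positive Bergman complex `B⁺(M_Φ)`: the classes of
flags of positive flats with the same matroid `M_𝓕`. A class stands for the union of the open
simplices of its members; the class of the empty flag is included. -/
def CoarseCell : Type _ := Quotient cs.coarseSetoid

/-- The coarse cell that contains the open simplex of the flag `𝓕`. -/
def coarseCell (𝓕 : cs.PosFlag) : cs.CoarseCell := Quotient.mk cs.coarseSetoid 𝓕

/-- The face order on coarse cells: `c ≤ d` iff `c` lies in the closure of `d`, i.e. every open
simplex of `c` is a face of some simplex of `d`. -/
instance : Preorder cs.CoarseCell where
  le c d := ∀ 𝓕 : cs.PosFlag, cs.coarseCell 𝓕 = c →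
    ∃ 𝓖 : cs.PosFlag, cs.coarseCell 𝓖 = d ∧ 𝓕.carrier ⊆ 𝓖.carrier
  le_refl c := fun 𝓕 h => ⟨𝓕, h, Subset.rfl⟩
  le_trans a b c := fun hab hbc 𝓕 h => by
    obtain ⟨𝓖, h𝓖, hs⟩ := hab 𝓕 h
    obtain ⟨𝓗, h𝓗, hs'⟩ := hbc 𝓖 h𝓖
    exact ⟨𝓗, h𝓗, hs.trans hs'⟩

end CoxeterSystem

/-! ### Tubings and graph associahedra -/

namespace GraphAssoc

open Set

variable {ι : Type*}

/-- A tube of a connected graph: a proper nonempty set of nodes whose induced graph is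
connected. -/
def IsTube (G : SimpleGraph ι) (t : Set ι) : Prop :=
  t.Nonempty ∧ t ≠ univ ∧ (G.induce t).Connected

/-- Two tubes intersect if they meet and neither contains the other. -/
def TubesIntersect (t u : Set ι) : Prop := (t ∩ u).Nonempty ∧ ¬ t ⊆ u ∧ ¬ u ⊆ t

/-- Two tubes are adjacent if they are disjoint and their union induces a connected graph. -/
def TubesAdjacent (G : SimpleGraph ι) (t u : Set ι) : Prop :=
  t ∩ u = ∅ ∧ (G.induce (t ∪ u)).Connected

/-- The tubings of a connected graph: the sets of tubes that are pairwise compatible, i.e. neither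
intersecting nor adjacent. They are ordered by containment. -/
abbrev Tubing (G : SimpleGraph ι) : Type _ :=
  {T : Set (Set ι) // (∀ t ∈ T, IsTube G t) ∧
    T.Pairwise fun t u => ¬ TubesIntersect t u ∧ ¬ TubesAdjacent G t u}

/-- `Q'` is obtained from the polytope `Q` by truncating its face `F`: it is cut off by a hyperplane
that has the vertices of `F` strictly on one side and all other vertices of `Q` strictly on
the other. -/
def IsTruncation (Q F Q' : Set (ι → ℝ)) : Prop :=
  ∃ (l : (ι → ℝ) →ₗ[ℝ] ℝ) (c : ℝ),
    (∀ x ∈ Q.extremePoints ℝ, x ∈ F → l x < c) ∧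
    (∀ x ∈ Q.extremePoints ℝ, x ∉ F → c < l x) ∧
    Q' = {x ∈ Q | c ≤ l x}

/-- `P` is obtained from `Q`, a truncation of the standard simplex, by truncating successively, for
`t` running through the list, the face that corresponds to the set `t` of nodes: what is left of
the face `⋂_{i ∈ t} {x_i = 0}` of the simplex. -/
inductive IsIteratedTruncation : Set (ι → ℝ) → List (Set ι) → Set (ι → ℝ) → Prop
  | nil (Q : Set (ι → ℝ)) : IsIteratedTruncation Q [] Q
  | cons (Q Q' P : Set (ι → ℝ)) (t : Set ι) (L : List (Set ι))
      (h : IsTruncation Q {x ∈ Q | ∀ i ∈ t, x i = 0} Q')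
      (h' : IsIteratedTruncation Q' L P) : IsIteratedTruncation Q (t :: L) P

/-- `P` is a graph associahedron of the connected graph `G`: it is obtained from the simplex whose
facets `x_i = 0` correspond to the nodes `i` of `G` by truncating all the faces that
correspond to tubes, in (weakly) increasing order of dimension of these faces, i.e. in
decreasing order of the size of the tubes. -/
def IsGraphAssociahedron [Finite ι] (G : SimpleGraph ι) (P : Set (ι → ℝ)) : Prop :=
  ∃ L : List (Set ι), L.Nodup ∧ (∀ t, t ∈ L ↔ IsTube G t) ∧
    L.Pairwise (fun t u => u.ncard ≤ t.ncard) ∧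
    IsIteratedTruncation
      {x : ι → ℝ | (∀ i, 0 ≤ x i) ∧ ∑ᶠ i, x i = 1} L P

/-- The poset of nonempty faces of a polytope (the polytope itself included), ordered by
inclusion. -/
abbrev Face {E : Type*} [AddCommGroup E] [Module ℝ E] [TopologicalSpace E] (P : Set E) : Type _ :=
  {F : Set E // F.Nonempty ∧ IsExposed ℝ P F}

end GraphAssoc

/-!
A positive flat is the set of positive roots of a standard parabolic subgroup, so a flag of positive
flats is a chain of sets of nodes `J₁ ⊂ ⋯ ⊂ Jₖ` of the diagram. The support of a positive root is
connected, and every connected set of nodes is the support of a positive root. Hence the matroid of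
the flag determines the connected components of the `Jᵢ` and of the diagram: if a connected set `t`
is not among them, there is a basis, consisting of simple roots and one positive root whose support
is larger than `t`, that does not span the roots supported in `t`. Apart from the components of the
diagram these components form a tubing, and a chain can be refined so as to realize any larger
tubing.

A nonempty face of a polyhedron is determined by the set of defining inequalities that are tight in
its relative interior. The effect of a truncation on the family of these sets depends only on the
family, so by induction the sets belonging to `P(Γ)` are found to be the nested sets of tubes,
whatever the choice of the hyperplanes; once all tubes are truncated, these are the tubings.
-/

/-! ### Components of induced subgraphs and compatible sets -/

namespace GraphAssoc

open Set

/-- `t` is (the node set of) a connected component of the subgraph induced by `J`. -/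
def IsComponent {V : Type*} (G : SimpleGraph V) (J t : Set V) : Prop :=
  Maximal (fun u => u ⊆ J ∧ (G.induce u).Connected) t

/-- Compatibility of two sets of nodes, as required of the tubes of a tubing. -/
def Compat {V : Type*} (G : SimpleGraph V) (t u : Set V) : Prop :=
  ¬ TubesIntersect t u ∧ ¬ TubesAdjacent G t u

/-- The components of the members of a family of sets of nodes. The tubing of a flag of parabolic
subsystems consists of the components of its members. -/
def comps {V : Type*} (G : SimpleGraph V) (𝓒 : Set (Set V)) : Set (Set V) :=
  {t | ∃ J ∈ 𝓒, IsComponent G J t}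

/-- Tubings of a graph that need not be connected. The components of the graph are excluded, as the
set of all nodes is for a connected graph. -/
abbrev GeneralTubing {V : Type*} (G : SimpleGraph V) : Type _ :=
  {T : Set (Set V) // (∀ t ∈ T, (G.induce t).Connected ∧ ¬ IsComponent G univ t) ∧
    T.Pairwise (Compat G)}

lemma sUnion_eq_empty_or_mem {α : Type*} {𝓒 : Set (Set α)} (hfin : 𝓒.Finite)
    (hchain : IsChain (· ⊆ ·) 𝓒) : ⋃₀ 𝓒 = ∅ ∨ ⋃₀ 𝓒 ∈ 𝓒 := by
  rcases eq_empty_or_nonempty 𝓒 with rfl | hne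
  · exact .inl sUnion_empty
  have hsup : SupClosed 𝓒 := fun J hJ K hK => by
    rcases hchain.total hJ hK with h | h
    · rwa [sup_eq_right.2 h]
    · rwa [sup_eq_left.2 h]
  exact .inr (hsup.sSup_mem_of_nonempty hfin hne Subset.rfl)

lemma not_subset_sUnion_not_subset {α : Type*} {𝓒 : Set (Set α)} (hfin : 𝓒.Finite)
    (hchain : IsChain (· ⊆ ·) 𝓒) {t : Set α} (ht : t.Nonempty) :
    ¬ t ⊆ ⋃₀ {J ∈ 𝓒 | ¬ t ⊆ J} := by
  rcases sUnion_eq_empty_or_mem (hfin.subset (sep_subset 𝓒 (¬ t ⊆ ·)))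
    (hchain.mono (sep_subset _ _)) with h | h
  · rw [h, subset_empty_iff]
    exact ht.ne_empty
  · exact h.2

variable {V : Type*} {G : SimpleGraph V} {J K t u : Set V}

lemma connected_induce_singleton (a : V) : (G.induce {a}).Connected := by
  rw [SimpleGraph.induce_singleton_eq_top]
  exact SimpleGraph.connected_top

lemma nonempty_of_connected (ht : (G.induce t).Connected) : t.Nonempty :=
  nonempty_coe_sort.1 ht.nonempty

lemma exists_adj_of_not_subset (hu : (G.induce u).Connected) (hne : (u ∩ t).Nonempty)
    (h : ¬ u ⊆ t) : ∃ a ∈ u ∩ t, ∃ b ∈ u \ t, G.Adj a b := by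
  obtain ⟨x, hxu, hxt⟩ := hne
  obtain ⟨y, hyu, hyt⟩ := not_subset.1 h
  obtain ⟨p⟩ := hu.preconnected ⟨x, hxu⟩ ⟨y, hyu⟩
  obtain ⟨d, -, hfst, hsnd⟩ := p.exists_boundary_dart {z | z.1 ∈ t} hxt hyt
  exact ⟨d.fst, ⟨d.fst.2, hfst⟩, d.snd, ⟨d.snd.2, hsnd⟩, d.adj⟩

namespace IsComponent

lemma subset (h : IsComponent G J t) : t ⊆ J := h.prop.1

lemma connected (h : IsComponent G J t) : (G.induce t).Connected := h.prop.2

lemma nonempty (h : IsComponent G J t) : t.Nonempty := nonempty_of_connected h.connected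

lemma subset_of_inter_nonempty (h : IsComponent G J t) (hu : (G.induce u).Connected)
    (huJ : u ⊆ J) (hne : (t ∩ u).Nonempty) : u ⊆ t :=
  subset_union_right.trans <| h.le_of_ge ⟨union_subset h.subset huJ,
    G.induce_union_connected h.connected.preconnected hu.preconnected hne⟩ subset_union_left

lemma mem_of_adj (h : IsComponent G J t) {a b : V} (ha : a ∈ t) (hb : b ∈ J) (hab : G.Adj a b) :
    b ∈ t :=
  h.subset_of_inter_nonempty (SimpleGraph.induce_pair_connected_of_adj hab)
    (pair_subset (h.subset ha) hb) ⟨a, ha, mem_insert _ _⟩ (mem_insert_of_mem _ rfl)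

lemma eq_of_inter_nonempty (h : IsComponent G J t) (h' : IsComponent G J u)
    (hne : (t ∩ u).Nonempty) : t = u :=
  (h'.subset_of_inter_nonempty h.connected h.subset (inter_comm t u ▸ hne)).antisymm
    (h.subset_of_inter_nonempty h'.connected h'.subset hne)

lemma eq_self (h : IsComponent G J t) (hJ : (G.induce J).Connected) : t = J :=
  h.subset.antisymm (h.le_of_ge ⟨Subset.rfl, hJ⟩ h.subset)

lemma of_subset (h : IsComponent G K t) (htJ : t ⊆ J) (hJK : J ⊆ K) : IsComponent G J t :=
  ⟨⟨htJ, h.connected⟩, fun _ hu htu => h.le_of_ge ⟨hu.1.trans hJK, hu.2⟩ htu⟩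

end IsComponent

lemma isComponent_self (h : (G.induce t).Connected) : IsComponent G t t :=
  ⟨⟨Subset.rfl, h⟩, fun _ hu _ => hu.1⟩

lemma exists_isComponent_superset (hu : (G.induce u).Connected) (huJ : u ⊆ J) :
    ∃ t, IsComponent G J t ∧ u ⊆ t := by
  have hmem : u ∈ {s | u ⊆ s ∧ s ⊆ J ∧ (G.induce s).Connected} := ⟨Subset.rfl, huJ, hu⟩
  refine ⟨⋃₀ {s | u ⊆ s ∧ s ⊆ J ∧ (G.induce s).Connected}, ⟨⟨sUnion_subset fun s hs => hs.2.1, ?_⟩,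
    fun s hs hle => subset_sUnion_of_mem ?_⟩, subset_sUnion_of_mem hmem⟩
  · exact SimpleGraph.induce_sUnion_connected_of_pairwise_not_disjoint ⟨u, hmem⟩
      (fun hs hs' => (nonempty_of_connected hu).mono (subset_inter hs.1 hs'.1)) fun hs => hs.2.2
  · exact ⟨(subset_sUnion_of_mem hmem).trans hle, hs⟩

lemma exists_isComponent_mem {a : V} (ha : a ∈ J) : ∃ t, IsComponent G J t ∧ a ∈ t := by
  simpa only [singleton_subset_iff] using
    exists_isComponent_superset (connected_induce_singleton (G := G) a) (singleton_subset_iff.2 ha)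

lemma isComponent_univ_iff : IsComponent G univ t ↔ ∃ C : G.ConnectedComponent, C.supp = t := by
  simp only [IsComponent, subset_univ, true_and,
    SimpleGraph.ConnectedComponent.maximal_connected_induce_iff]

lemma compat_iff (ht : (G.induce t).Connected) (hu : (G.induce u).Connected) :
    Compat G t u ↔ t ⊆ u ∨ u ⊆ t ∨ (t ∩ u = ∅ ∧ ∀ a ∈ t, ∀ b ∈ u, ¬ G.Adj a b) := by
  have htne := nonempty_of_connected ht
  have hune := nonempty_of_connected hu
  constructor
  · rintro ⟨hinter, hadj⟩
    by_contra! hcon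
    obtain ⟨htu, hut, hedge⟩ := hcon
    have hdisj : t ∩ u = ∅ := by
      by_contra hne
      exact hinter ⟨nonempty_iff_ne_empty.2 hne, htu, hut⟩
    obtain ⟨a, ha, b, hb, hab⟩ := hedge hdisj
    exact hadj ⟨hdisj, G.connected_induce_union ht.preconnected hu.preconnected ha hb hab⟩
  · rintro (h | h | ⟨hdisj, hedge⟩)
    · exact ⟨fun h' => h'.2.1 h, fun h' => htne.ne_empty (by rw [← h'.1, inter_eq_left.2 h])⟩
    · exact ⟨fun h' => h'.2.2 h, fun h' => hune.ne_empty (by rw [← h'.1, inter_eq_right.2 h])⟩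
    · refine ⟨fun h' => h'.1.ne_empty hdisj, fun h' => ?_⟩
      have hut : ¬ t ∪ u ⊆ t := fun h => hune.ne_empty
        (by rw [← hdisj, inter_eq_right.2 (subset_union_right.trans h)])
      obtain ⟨a, ha, b, hb, hab⟩ := exists_adj_of_not_subset h'.2
        (htne.mono (subset_inter subset_union_left Subset.rfl)) hut
      exact hedge a ha.2 b (hb.1.resolve_left hb.2) hab

lemma Compat.symm (h : Compat G t u) : Compat G u t := by
  rwa [Compat, TubesIntersect, TubesAdjacent, inter_comm, union_comm, and_comm (a := ¬ u ⊆ t)]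

lemma IsComponent.compat (ht : IsComponent G J t) (hu : IsComponent G K u) (hJK : J ⊆ K) :
    Compat G t u := by
  rw [compat_iff ht.connected hu.connected]
  by_cases hne : (u ∩ t).Nonempty
  · exact .inl (hu.subset_of_inter_nonempty ht.connected (ht.subset.trans hJK) hne)
  · rw [inter_comm, not_nonempty_iff_eq_empty] at hne
    exact .inr (.inr ⟨hne, fun a ha b hb hab =>
      notMem_empty a (hne ▸ ⟨ha, hu.mem_of_adj hb (hJK (ht.subset ha)) hab.symm⟩)⟩)

lemma comps_mono {𝓒 𝓓 : Set (Set V)} (h : 𝓒 ⊆ 𝓓) : comps G 𝓒 ⊆ comps G 𝓓 :=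
  fun _ ⟨J, hJ, ht⟩ => ⟨J, h hJ, ht⟩

lemma comps_insert (J : Set V) (𝓒 : Set (Set V)) :
    comps G (insert J 𝓒) = {t | IsComponent G J t} ∪ comps G 𝓒 := by
  ext t
  simp only [comps, exists_mem_insert, mem_ofPred_eq, mem_union]

lemma compat_of_mem_comps {𝓒 : Set (Set V)} (h : IsChain (· ⊆ ·) 𝓒) (ht : t ∈ comps G 𝓒)
    (hu : u ∈ comps G 𝓒) : Compat G t u := by
  obtain ⟨J, hJ, ht⟩ := ht
  obtain ⟨K, hK, hu⟩ := hu
  rcases h.total hJ hK with h | h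
  · exact ht.compat hu h
  · exact (hu.compat ht h).symm

lemma exists_connected_ssuperset_of_notMem_comps {𝓒 : Set (Set V)} (hfin : 𝓒.Finite)
    (hchain : IsChain (· ⊆ ·) 𝓒) (huniv : univ ∈ 𝓒) (ht : (G.induce t).Connected)
    (ht𝓒 : t ∉ comps G 𝓒) :
    ∃ C, (G.induce C).Connected ∧ t ⊂ C ∧ ∃ j ∈ t, ∀ J ∈ 𝓒, j ∈ J → C ⊆ J := by
  obtain ⟨K, ⟨hK, htK⟩, hmin⟩ := (hfin.subset (sep_subset 𝓒 (t ⊆ ·))).exists_minimal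
    ⟨univ, huniv, subset_univ t⟩
  obtain ⟨C, hC, htC⟩ := exists_isComponent_superset ht htK
  obtain ⟨j, hjt, hj⟩ := not_subset.1
    (not_subset_sUnion_not_subset hfin hchain (nonempty_of_connected ht))
  refine ⟨C, hC.connected, htC.ssubset_of_ne ?_, j, hjt, fun J hJ hjJ => hC.subset.trans ?_⟩
  · rintro rfl
    exact ht𝓒 ⟨K, hK, hC⟩
  · have htJ : t ⊆ J := by
      by_contra htJ
      exact hj (mem_sUnion_of_mem hjJ ⟨hJ, htJ⟩)
    exact (hchain.total hK hJ).elim id (hmin ⟨hJ, htJ⟩)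

/-! ### Refining a chain to realize a tubing -/

lemma isComponent_union_right (ht : (G.induce t).Connected)
    (hK : ∀ u, IsComponent G K u → Compat G u t) (htK : ¬ t ⊆ K) : IsComponent G (K ∪ t) t := by
  refine ⟨⟨subset_union_right, ht⟩, fun s hs hts => ?_⟩
  by_contra hst
  obtain ⟨a, ha, b, hb, hab⟩ := exists_adj_of_not_subset hs.2
    ((nonempty_of_connected ht).mono (subset_inter hts Subset.rfl)) hst
  obtain ⟨u, hu, hbu⟩ := exists_isComponent_mem (G := G) ((hs.1 hb.1).resolve_right hb.2)
  rcases (compat_iff hu.connected ht).1 (hK u hu) with h | h | h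
  · exact hb.2 (h hbu)
  · exact htK (h.trans hu.subset)
  · exact h.2 b hbu a ha.2 hab.symm

lemma IsComponent.eq_or_of_union {c : Set V} (ht : IsComponent G (K ∪ t) t)
    (hc : IsComponent G (K ∪ t) c) : c = t ∨ IsComponent G K c := by
  by_cases hne : (c ∩ t).Nonempty
  · exact .inl (hc.eq_of_inter_nonempty ht hne)
  · refine .inr (hc.of_subset (fun x hx => (hc.subset hx).resolve_right fun hxt => ?_)
      subset_union_left)
    exact hne ⟨x, hx, hxt⟩

lemma isChain_insert_sUnion_union {α : Type*} {𝓒 : Set (Set α)} (hchain : IsChain (· ⊆ ·) 𝓒)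
    (t : Set α) : IsChain (· ⊆ ·) (insert (⋃₀ {J ∈ 𝓒 | ¬ t ⊆ J} ∪ t) 𝓒) := by
  refine hchain.insert fun J hJ _ => ?_
  by_cases htJ : t ⊆ J
  · exact .inl (union_subset (sUnion_subset fun I hI =>
      (hchain.total hI.1 hJ).resolve_right fun hJI => hI.2 (htJ.trans hJI)) htJ)
  · exact .inr ((subset_sUnion_of_mem
      (show J ∈ {J ∈ 𝓒 | ¬ t ⊆ J} from ⟨hJ, htJ⟩)).trans subset_union_left)

lemma exists_isChain_insert [Finite V] {T : Set (Set V)} (hconn : ∀ u ∈ T, (G.induce u).Connected)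
    (hT : T.Pairwise (Compat G)) {𝓒 : Set (Set V)} (h𝓒 : IsChain (· ⊆ ·) 𝓒)
    (h𝓒T : comps G 𝓒 ⊆ T) (ht : t ∈ T) :
    ∃ J, IsComponent G J t ∧ IsChain (· ⊆ ·) (insert J 𝓒) ∧ comps G (insert J 𝓒) ⊆ T := by
  set K : Set V := ⋃₀ {J ∈ 𝓒 | ¬ t ⊆ J}
  have hK : K = ∅ ∨ K ∈ {J ∈ 𝓒 | ¬ t ⊆ J} :=
    sUnion_eq_empty_or_mem (toFinite _) (h𝓒.mono (sep_subset _ _))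
  have htK : ¬ t ⊆ K :=
    not_subset_sUnion_not_subset (toFinite _) h𝓒 (nonempty_of_connected (hconn t ht))
  have hKT : ∀ u, IsComponent G K u → u ∈ T := fun u hu => by
    rcases hK with h | h
    · exact absurd (subset_empty_iff.1 (h ▸ hu.subset)) hu.nonempty.ne_empty
    · exact h𝓒T ⟨K, h.1, hu⟩
  have htKt : IsComponent G (K ∪ t) t := isComponent_union_right (hconn t ht) (fun u hu =>
    hT (hKT u hu) ht fun hut => htK (hut ▸ hu.subset)) htK
  refine ⟨K ∪ t, htKt, isChain_insert_sUnion_union h𝓒 t, ?_⟩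
  rw [comps_insert]
  refine union_subset (fun c hc => ?_) h𝓒T
  rcases htKt.eq_or_of_union hc with rfl | hc
  · exact ht
  · exact hKT c hc

lemma exists_isChain_comps_eq [Finite V] {T : Set (Set V)}
    (hconn : ∀ u ∈ T, (G.induce u).Connected) (hT : T.Pairwise (Compat G)) {𝓒 : Set (Set V)}
    (h𝓒 : IsChain (· ⊆ ·) 𝓒) (h𝓒T : comps G 𝓒 ⊆ T) :
    ∃ 𝓓, 𝓒 ⊆ 𝓓 ∧ IsChain (· ⊆ ·) 𝓓 ∧ (∀ J ∈ 𝓓, J ∈ 𝓒 ∨ J.Nonempty) ∧ comps G 𝓓 = T := by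
  obtain ⟨𝓓, h𝓒𝓓, h𝓓⟩ := Finite.exists_le_maximal (a := 𝓒) (p := fun 𝓓 : Set (Set V) =>
    IsChain (· ⊆ ·) 𝓓 ∧ (∀ J ∈ 𝓓, J ∈ 𝓒 ∨ J.Nonempty) ∧ comps G 𝓓 ⊆ T)
    ⟨h𝓒, fun J hJ => .inl hJ, h𝓒T⟩
  obtain ⟨hchain, hne, hsub⟩ := h𝓓.prop
  refine ⟨𝓓, h𝓒𝓓, hchain, hne, hsub.antisymm fun t ht => ?_⟩
  obtain ⟨J, htJ, hJchain, hJT⟩ := exists_isChain_insert hconn hT hchain hsub ht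
  refine ⟨J, h𝓓.le_of_ge ⟨hJchain, ?_, hJT⟩ (subset_insert J 𝓓) (mem_insert J 𝓓), htJ⟩
  rintro I (rfl | hI)
  · exact .inr (htJ.nonempty.mono htJ.subset)
  · exact hne I hI

/-! ### Tubings of connected graphs and of disjoint unions -/

lemma isTube_iff_of_connected (hG : G.Connected) :
    IsTube G t ↔ (G.induce t).Connected ∧ ¬ IsComponent G univ t := by
  have hGuniv : (G.induce univ).Connected := (SimpleGraph.induceUnivIso G).connected_iff.2 hG
  have huniv : IsComponent G univ t ↔ t = univ :=
    ⟨fun ht => ht.eq_self hGuniv, by rintro rfl; exact isComponent_self hGuniv⟩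
  rw [huniv]
  exact ⟨fun h => ⟨h.2.2, h.2.1⟩, fun h => ⟨nonempty_of_connected h.1, h.2, h.1⟩⟩

/-- On a connected graph, general tubings are the same as tubings. -/
def generalTubingOrderIsoTubing (hG : G.Connected) : GeneralTubing G ≃o Tubing G where
  toEquiv := Equiv.subtypeEquivRight fun T => by
    simp only [isTube_iff_of_connected hG]
    rfl
  map_rel_iff' := Iff.rfl

lemma connected_induce_image_val {s : Set V} (t : Set s) :
    (G.induce (Subtype.val '' t)).Connected ↔ ((G.induce s).induce t).Connected := by
  let e : (G.induce s).induce t ≃g G.induce (Subtype.val '' t) :=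
    { toEquiv := Equiv.Set.image _ t Subtype.val_injective
      map_rel_iff' := Iff.rfl }
  exact e.connected_iff.symm

lemma compat_image_val {s : Set V} (t u : Set s) :
    Compat G (Subtype.val '' t) (Subtype.val '' u) ↔ Compat (G.induce s) t u := by
  have hinj := Subtype.val_injective (p := (· ∈ s))
  rw [Compat, Compat, TubesIntersect, TubesIntersect, TubesAdjacent, TubesAdjacent,
    ← image_inter hinj, ← image_union, connected_induce_image_val, image_nonempty, image_eq_empty,
    image_subset_image_iff hinj, image_subset_image_iff hinj]

section ConnectedComponents

variable {C D : G.ConnectedComponent}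

lemma isComponent_supp (C : G.ConnectedComponent) : IsComponent G univ C.supp :=
  isComponent_univ_iff.2 ⟨C, rfl⟩

lemma exists_eq_image_val_of_connected (ht : (G.induce t).Connected) :
    ∃ (C : G.ConnectedComponent) (u : Set C.supp), t = Subtype.val '' u := by
  obtain ⟨s, hs, hts⟩ := exists_isComponent_superset ht (subset_univ t)
  obtain ⟨C, rfl⟩ := isComponent_univ_iff.1 hs
  exact ⟨C, Subtype.val ⁻¹' t, by rw [Subtype.image_preimage_coe, inter_eq_right.2 hts]⟩

lemma isTube_induce_supp_iff (t : Set C.supp) :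
    IsTube (G.induce C.supp) t ↔ (G.induce (Subtype.val '' t)).Connected ∧
      ¬ IsComponent G univ (Subtype.val '' t) := by
  have himage : Subtype.val '' t = C.supp ↔ t = univ := by
    rw [← Subtype.val_injective.image_injective.eq_iff, Subtype.coe_image_univ]
  rw [IsTube, connected_induce_image_val, Ne, ← himage]
  constructor
  · rintro ⟨hne, huniv, hconn⟩
    refine ⟨hconn, fun hcomp => huniv (hcomp.eq_of_inter_nonempty (isComponent_supp C) ?_)⟩
    exact (hne.image _).mono (subset_inter Subset.rfl (Subtype.coe_image_subset _ _))
  · rintro ⟨hconn, hcomp⟩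
    have hne : t.Nonempty := nonempty_of_connected hconn
    refine ⟨hne, fun h => hcomp ?_, hconn⟩
    exact h.symm ▸ isComponent_supp C

lemma supp_eq_of_mem {a : V} (haC : a ∈ C.supp) (haD : a ∈ D.supp) : C = D := by
  rw [SimpleGraph.ConnectedComponent.mem_supp_iff] at haC haD
  rw [← haC, haD]

lemma compat_image_val_of_ne (hCD : C ≠ D) {t : Set C.supp} {u : Set D.supp}
    (ht : IsTube (G.induce C.supp) t) (hu : IsTube (G.induce D.supp) u) :
    Compat G (Subtype.val '' t) (Subtype.val '' u) := by
  rw [compat_iff ((connected_induce_image_val t).2 ht.2.2)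
    ((connected_induce_image_val u).2 hu.2.2)]
  refine .inr (.inr ⟨eq_empty_iff_forall_notMem.2 ?_, ?_⟩)
  · rintro _ ⟨⟨x, -, rfl⟩, y, -, hyx⟩
    exact hCD (supp_eq_of_mem x.2 (hyx ▸ y.2))
  · rintro _ ⟨x, -, rfl⟩ _ ⟨y, -, rfl⟩ hxy
    exact hCD (supp_eq_of_mem ((isComponent_supp C).mem_of_adj x.2 (mem_univ _) hxy) y.2)

end ConnectedComponents

namespace GeneralTubing

lemma pairwise_compat_union (T : GeneralTubing G) :
    (T.1 ∪ {t | IsComponent G univ t}).Pairwise (Compat G) := by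
  have : Std.Symm (Compat G) := ⟨fun _ _ => Compat.symm⟩
  refine pairwise_union_of_symm.2 ⟨T.2.2, ?_, ?_⟩
  · exact fun t ht u hu _ => ht.compat hu Subset.rfl
  · exact fun t ht u hu _ => (isComponent_self (T.2.1 t ht).1).compat hu (subset_univ t)

/-- The part of a general tubing inside a connected component of the graph. -/
def restrict (T : GeneralTubing G) (C : G.ConnectedComponent) : Tubing (G.induce C.supp) :=
  ⟨{t | Subtype.val '' t ∈ T.1}, fun t ht => (isTube_induce_supp_iff t).2 (T.2.1 _ ht),
    fun t ht u hu htu =>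
      (compat_image_val t u).1 (T.2.2 ht hu (Subtype.val_injective.image_injective.ne htu))⟩

lemma restrict_le_restrict_iff {T T' : GeneralTubing G} :
    T.restrict ≤ T'.restrict ↔ T ≤ T' := by
  refine ⟨fun h t ht => ?_, fun h C t ht => h ht⟩
  obtain ⟨C, u, rfl⟩ := exists_eq_image_val_of_connected (T.2.1 t ht).1
  exact h C ht

lemma restrict_surjective :
    Function.Surjective (restrict (G := G)) := by
  intro S
  refine ⟨⟨{t | ∃ C, ∃ u ∈ (S C).1, t = Subtype.val '' u}, ?_, ?_⟩, ?_⟩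
  · rintro _ ⟨C, u, hu, rfl⟩
    exact (isTube_induce_supp_iff u).1 ((S C).2.1 u hu)
  · rintro _ ⟨C, t, ht, rfl⟩ _ ⟨D, u, hu, rfl⟩ hne
    by_cases hCD : C = D
    · subst hCD
      exact (compat_image_val t u).2 ((S C).2.2 ht hu fun h => hne (h ▸ rfl))
    · exact compat_image_val_of_ne hCD ((S C).2.1 t ht) ((S D).2.1 u hu)
  · funext C
    refine Subtype.ext (Subset.antisymm ?_ fun t ht => ⟨C, t, ht, rfl⟩)
    rintro t ⟨D, u, hu, htu⟩
    obtain ⟨x, hx⟩ := ((S D).2.1 u hu).1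
    obtain ⟨y, -, hyx⟩ : (x : V) ∈ Subtype.val '' t := htu ▸ mem_image_of_mem _ hx
    obtain rfl : C = D := supp_eq_of_mem y.2 (hyx ▸ x.2)
    rwa [Subtype.val_injective.image_injective htu]

/-- A general tubing is a tuple of tubings of the connected components. -/
noncomputable def orderIsoPi :
    GeneralTubing G ≃o ∀ C : G.ConnectedComponent, Tubing (G.induce C.supp) :=
  OrderIso.ofSurjective (OrderEmbedding.ofMapLEIff restrict fun _ _ => restrict_le_restrict_iff)
    restrict_surjective

end GeneralTubing

end GraphAssoc

/-! ### Faces of polyhedra -/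

namespace GraphAssoc

open Set Filter Topology

section Polyhedron

variable {E : Type*} [NormedAddCommGroup E] [NormedSpace ℝ E] {A : Type*}

/-- The polyhedron in the affine subspace `H` defined by the inequalities `0 ≤ g a`. -/
def polyhedron (H : AffineSubspace ℝ E) (g : A → E →ᵃ[ℝ] ℝ) : Set E :=
  {x | x ∈ H ∧ ∀ a, 0 ≤ g a x}

/-- The indices of the inequalities that are tight at `x`. -/
def active (g : A → E →ᵃ[ℝ] ℝ) (x : E) : Set A := {a | g a x = 0}

/-- The active sets of the points of a polyhedron: the combinatorial type of the polyhedron. -/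
def activeSets (H : AffineSubspace ℝ E) (g : A → E →ᵃ[ℝ] ℝ) : Set (Set A) :=
  active g '' polyhedron H g

/-- The face of a polyhedron on which the inequalities in `σ` are tight. -/
def faceOf (H : AffineSubspace ℝ E) (g : A → E →ᵃ[ℝ] ℝ) (σ : Set A) : Set E :=
  {x ∈ polyhedron H g | σ ⊆ active g x}

variable {H : AffineSubspace ℝ E} {g : A → E →ᵃ[ℝ] ℝ} {σ τ : Set A} {x y z : E}

lemma convex_polyhedron : Convex ℝ (polyhedron H g) := by
  have : polyhedron H g = (H : Set E) ∩ ⋂ a, g a ⁻¹' Ici 0 := by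
    ext x; simp [polyhedron]
  rw [this]
  exact H.convex.inter (convex_iInter fun a => (convex_Ici 0).affine_preimage (g a))

lemma isClosed_polyhedron [FiniteDimensional ℝ E] : IsClosed (polyhedron H g) := by
  have : polyhedron H g = (H : Set E) ∩ ⋂ a, {x | 0 ≤ g a x} := by
    ext x; simp [polyhedron]
  rw [this]
  exact H.closed_of_finiteDimensional.inter (isClosed_iInter fun a =>
    isClosed_le continuous_const (g a).continuous_of_finiteDimensional)

lemma active_eq_inter_of_mem_openSegment (hx : x ∈ polyhedron H g) (hy : y ∈ polyhedron H g)
    (hz : z ∈ openSegment ℝ x y) : active g z = active g x ∩ active g y := by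
  obtain ⟨r, s, hr, hs, hrs, rfl⟩ := hz
  ext a
  simp only [active, mem_ofPred_eq, mem_inter_iff, Convex.combo_affine_apply hrs, smul_eq_mul]
  rw [add_eq_zero_iff_of_nonneg (mul_nonneg hr.le (hx.2 a)) (mul_nonneg hs.le (hy.2 a)),
    mul_eq_zero_iff_left hr.ne', mul_eq_zero_iff_left hs.ne']

lemma convex_setOf_active_eq : Convex ℝ {x ∈ polyhedron H g | active g x = τ} := by
  rw [convex_iff_openSegment_subset]
  rintro x ⟨hx, hxτ⟩ y ⟨hy, hyτ⟩ z hz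
  exact ⟨convex_polyhedron.openSegment_subset hx hy hz, by
    rw [active_eq_inter_of_mem_openSegment hx hy hz, hxτ, hyτ, inter_self]⟩

lemma exists_mem_openSegment [Finite A] (hx : x ∈ polyhedron H g) (hy : y ∈ H)
    (hxy : active g x ⊆ active g y) : ∃ z ∈ polyhedron H g, x ∈ openSegment ℝ y z := by
  have hnonneg (a : A) : ∀ᶠ r in 𝓝 (1 : ℝ), 0 ≤ g a (AffineMap.lineMap y x r) := by
    simp only [AffineMap.apply_lineMap]
    by_cases ha : a ∈ active g x
    · have hax : g a x = 0 := ha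
      have hay : g a y = 0 := hxy ha
      simp [hax, hay]
    · have hcont := (AffineMap.lineMap_continuous (R := ℝ) (p := g a y) (q := g a x)).tendsto 1
      rw [AffineMap.lineMap_apply_one] at hcont
      exact (hcont.eventually (lt_mem_nhds ((hx.2 a).lt_of_ne' ha))).mono fun r hr => hr.le
  obtain ⟨r, hr, hr1⟩ := ((eventually_all.2 hnonneg).filter_mono nhdsWithin_le_nhds |>.and
    (self_mem_nhdsWithin (s := Ioi (1 : ℝ)))).exists
  have hr0 : 0 < r := one_pos.trans hr1
  refine ⟨AffineMap.lineMap y x r, ⟨AffineMap.lineMap_mem r hy hx.1, hr⟩, ?_⟩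
  rw [openSegment_eq_image_lineMap]
  refine ⟨r⁻¹, ⟨inv_pos.2 hr0, inv_lt_one_of_one_lt₀ hr1⟩, ?_⟩
  rw [AffineMap.lineMap_lineMap_right, inv_mul_cancel₀ hr0.ne', AffineMap.lineMap_apply_one]

lemma isExposed_faceOf [FiniteDimensional ℝ E] [Finite A] (σ : Set A) :
    IsExposed ℝ (polyhedron H g) (faceOf H g σ) := by
  rintro ⟨x₀, hx₀, hσ⟩
  lift σ to Finset A using σ.toFinite
  let l : StrongDual ℝ E := -∑ a ∈ σ, LinearMap.toContinuousLinearMap (g a).linear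
  have hl (x y : E) : l y ≤ l x ↔ ∑ a ∈ σ, g a x ≤ ∑ a ∈ σ, g a y := by
    have hsub : ∑ a ∈ σ, g a y - ∑ a ∈ σ, g a x = l x - l y := by
      rw [← Finset.sum_sub_distrib, ← map_sub]
      simp only [← vsub_eq_sub, ← AffineMap.linearMap_vsub]
      simp [l]
    rw [← sub_nonneg, ← hsub, sub_nonneg]
  have hnonneg {y : E} (hy : y ∈ polyhedron H g) : 0 ≤ ∑ a ∈ σ, g a y :=
    Finset.sum_nonneg fun a _ => hy.2 a
  have hzero {y : E} (hy : y ∈ polyhedron H g) : ∑ a ∈ σ, g a y = 0 ↔ ↑σ ⊆ active g y :=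
    Finset.sum_eq_zero_iff_of_nonneg fun a _ => hy.2 a
  refine ⟨l, Set.ext fun x => ⟨fun hx => ⟨hx.1, fun y hy => ?_⟩, fun hx => ⟨hx.1, ?_⟩⟩⟩
  · rw [hl, (hzero hx.1).2 hx.2]
    exact hnonneg hy
  · have hle := (hl _ _).1 (hx.2 x₀ hx₀)
    rw [(hzero hx₀).2 hσ] at hle
    exact (hzero hx.1).1 (hle.antisymm (hnonneg hx.1))

/-- A face is determined by the active set of any point in its relative interior, that is, of any
point whose active set is minimal. -/
lemma exists_faceOf_eq_of_isExposed [Finite A] {F : Set E} (hne : F.Nonempty)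
    (hF : IsExposed ℝ (polyhedron H g) F) : ∃ σ ∈ activeSets H g, F = faceOf H g σ := by
  obtain ⟨τ, hτ⟩ := (active g '' F).toFinite.exists_minimal (hne.image _)
  obtain ⟨x, hx, rfl⟩ := hτ.prop
  refine ⟨active g x, ⟨x, hF.subset hx, rfl⟩, Subset.antisymm (fun y hy => ⟨hF.subset hy, ?_⟩) ?_⟩
  · obtain ⟨z, hz⟩ : (openSegment ℝ x y).Nonempty := ⟨_, midpoint_mem_openSegment x y⟩
    have hact := active_eq_inter_of_mem_openSegment (hF.subset hx) (hF.subset hy) hz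
    have hzF : z ∈ F := (hF.convex convex_polyhedron).openSegment_subset hx hy hz
    exact (hτ.le_of_le (mem_image_of_mem _ hzF) (hact.le.trans inter_subset_left)).trans
      (hact.le.trans inter_subset_right)
  · rintro y ⟨hy, hxy⟩
    obtain ⟨z, hz, hxz⟩ := exists_mem_openSegment (hF.subset hx) hy.1 hxy
    exact hF.isExtreme.left_mem_of_mem_openSegment hy hz hx hxz

lemma faceOf_subset_faceOf_iff (hτ : τ ∈ activeSets H g) :
    faceOf H g τ ⊆ faceOf H g σ ↔ σ ⊆ τ := by
  obtain ⟨x, hx, rfl⟩ := hτ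
  exact ⟨fun h => (h ⟨hx, Subset.rfl⟩).2, fun h y hy => ⟨hy.1, h.trans hy.2⟩⟩

/-- The poset of nonempty faces of a polyhedron is dual to the poset of active sets. -/
noncomputable def activeSetsOrderIsoFace [FiniteDimensional ℝ E] [Finite A] :
    activeSets H g ≃o (Face (polyhedron H g))ᵒᵈ :=
  OrderIso.ofSurjective
    (OrderEmbedding.ofMapLEIff
      (fun σ => OrderDual.toDual ⟨faceOf H g σ.1, by
        obtain ⟨x, hx, h⟩ := σ.2
        exact ⟨x, hx, h.ge⟩, isExposed_faceOf σ.1⟩)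
      fun _ τ => faceOf_subset_faceOf_iff τ.2)
    fun F => by
      obtain ⟨σ, hσ, hF⟩ := exists_faceOf_eq_of_isExposed F.ofDual.2.1 F.ofDual.2.2
      exact ⟨⟨σ, hσ⟩, Subtype.ext hF.symm⟩

lemma finite_extremePoints [Finite A] : ((polyhedron H g).extremePoints ℝ).Finite := by
  refine Set.Finite.of_finite_image (f := active g) (Set.toFinite _) fun x hx y hy hxy => ?_
  obtain ⟨z, hz, hxz⟩ := exists_mem_openSegment hx.1 hy.1.1 hxy.le
  exact (hx.2 hy.1 hz hxz).symm

lemma exists_extremePoint_ge [FiniteDimensional ℝ E] [Finite A]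
    (hQ : IsCompact (polyhedron H g)) (hx : x ∈ faceOf H g σ) (h : E →ᵃ[ℝ] ℝ) :
    ∃ v ∈ (polyhedron H g).extremePoints ℝ, v ∈ faceOf H g σ ∧ h x ≤ h v := by
  have hcompact : IsCompact (faceOf H g σ) := (isExposed_faceOf σ).isCompact hQ
  let l : StrongDual ℝ E := LinearMap.toContinuousLinearMap h.linear
  have hK : IsExposed ℝ (faceOf H g σ) (l.toExposed (faceOf H g σ)) :=
    ContinuousLinearMap.toExposed.isExposed
  obtain ⟨m, hm, hmax⟩ := hcompact.exists_isMaxOn ⟨x, hx⟩ l.continuous.continuousOn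
  obtain ⟨v, hv⟩ := (hK.isCompact hcompact).extremePoints_nonempty ⟨m, hm, hmax⟩
  have hvK := extremePoints_subset hv
  refine ⟨v, ((isExposed_faceOf σ).isExtreme.trans
    hK.isExtreme).extremePoints_subset_extremePoints hv, hvK.1, ?_⟩
  have hvx : l v - l x = h v - h x := by
    rw [← map_sub]
    exact h.linearMap_vsub v x
  linarith [hvK.2 x hx]

end Polyhedron

section CutsOff

variable {E : Type*} [NormedAddCommGroup E] [NormedSpace ℝ E] {A : Type*}

/-- The hyperplane `h = 0` cuts the face `faceOf H g σ` off the polyhedron, as in a truncation. -/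
def CutsOff (H : AffineSubspace ℝ E) (g : A → E →ᵃ[ℝ] ℝ) (σ : Set A) (h : E →ᵃ[ℝ] ℝ) : Prop :=
  (∀ x ∈ (polyhedron H g).extremePoints ℝ, x ∈ faceOf H g σ → h x < 0) ∧
    ∀ x ∈ (polyhedron H g).extremePoints ℝ, x ∉ faceOf H g σ → 0 < h x

variable {H : AffineSubspace ℝ E} {g : A → E →ᵃ[ℝ] ℝ} {σ τ : Set A} {x y : E} {h : E →ᵃ[ℝ] ℝ}

lemma exists_active_eq_of_pos [FiniteDimensional ℝ E] (hx : x ∈ polyhedron H g)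
    (hy : y ∈ polyhedron H g) (hxy : active g y ⊆ active g x) (hpos : 0 < h x) :
    ∃ z ∈ polyhedron H g, active g z = active g y ∧ 0 < h z := by
  have hmem : x ∈ closure (openSegment ℝ x y) := by
    rw [closure_openSegment]
    exact left_mem_segment ℝ x y
  obtain ⟨z, hz, hzxy⟩ := mem_closure_iff.1 hmem {z | 0 < h z}
    (isOpen_lt continuous_const h.continuous_of_finiteDimensional) hpos
  exact ⟨z, convex_polyhedron.openSegment_subset hx hy hzxy,
    by rw [active_eq_inter_of_mem_openSegment hx hy hzxy, inter_eq_right.2 hxy], hz⟩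

lemma exists_active_eq_of_neg_of_pos [FiniteDimensional ℝ E] (hx : x ∈ polyhedron H g)
    (hy : y ∈ polyhedron H g) (hxy : active g x = active g y) (hneg : h x < 0) (hpos : 0 < h y) :
    ∃ z ∈ polyhedron H g, active g z = active g y ∧ h z = 0 := by
  obtain ⟨z, hz, hz0⟩ := convex_setOf_active_eq.isPreconnected.intermediate_value
    ⟨hx, hxy⟩ ⟨hy, rfl⟩ h.continuous_of_finiteDimensional.continuousOn ⟨hneg.le, hpos.le⟩
  exact ⟨z, hz.1, hz.2, hz0⟩

namespace CutsOff

variable [FiniteDimensional ℝ E] [Finite A]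

lemma neg_of_mem_faceOf (hcut : CutsOff H g σ h) (hQ : IsCompact (polyhedron H g))
    (hx : x ∈ faceOf H g σ) : h x < 0 := by
  obtain ⟨v, hv, hvσ, hle⟩ := exists_extremePoint_ge hQ hx h
  exact hle.trans_lt (hcut.1 v hv hvσ)

lemma exists_pos (hcut : CutsOff H g σ h) (hQ : IsCompact (polyhedron H g))
    (hx : x ∈ polyhedron H g) (hσ : ¬ σ ⊆ active g x) :
    ∃ y ∈ polyhedron H g, active g y = active g x ∧ 0 < h y := by
  obtain ⟨a, haσ, hax⟩ := not_subset.1 hσ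
  obtain ⟨v, hv, hvx, hle⟩ := exists_extremePoint_ge hQ (σ := active g x) ⟨hx, Subset.rfl⟩ (g a)
  have hav : 0 < g a v := ((hx.2 a).lt_of_ne' hax).trans_le hle
  exact exists_active_eq_of_pos hvx.1 hx hvx.2 (hcut.2 v hv fun hvσ => hav.ne' (hvσ.2 haσ))

lemma exists_superset_of_nonpos (hcut : CutsOff H g σ h) (hQ : IsCompact (polyhedron H g))
    (hx : x ∈ polyhedron H g) (hle : h x ≤ 0) : ∃ ρ ∈ activeSets H g, σ ∪ active g x ⊆ ρ := by
  obtain ⟨v, hv, hvx, hxv⟩ := exists_extremePoint_ge hQ (σ := active g x) ⟨hx, Subset.rfl⟩ (-h)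
  have hvσ : v ∈ faceOf H g σ := by
    by_contra hvσ
    exact (hcut.2 v hv hvσ).not_ge ((neg_le_neg_iff.1 hxv).trans hle)
  exact ⟨active g v, ⟨v, hv.1, rfl⟩, union_subset hvσ.2 hvx.2⟩

lemma exists_eq_zero (hcut : CutsOff H g σ h) (hQ : IsCompact (polyhedron H g))
    (hx : x ∈ polyhedron H g) (hσ : ¬ σ ⊆ active g x) {ρ : Set A} (hρ : ρ ∈ activeSets H g)
    (hsub : σ ∪ active g x ⊆ ρ) : ∃ y ∈ polyhedron H g, active g y = active g x ∧ h y = 0 := by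
  obtain ⟨y, hy, hyx, hpos⟩ := hcut.exists_pos hQ hx hσ
  obtain ⟨u, hu, rfl⟩ := hρ
  have hneg : h u < 0 := hcut.neg_of_mem_faceOf hQ ⟨hu, subset_union_left.trans hsub⟩
  obtain ⟨w, hw, hwx, hwneg⟩ := exists_active_eq_of_pos (h := -h) hu hx
    (subset_union_right.trans hsub) (neg_pos.2 hneg)
  rw [← hyx]
  exact exists_active_eq_of_neg_of_pos hw hy (hwx.trans hyx.symm) (neg_pos.1 hwneg) hpos

end CutsOff

variable [DecidableEq A] {s : A}

lemma mem_polyhedron_update (hs : ∀ x, g s x = 1) :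
    x ∈ polyhedron H (Function.update g s h) ↔ x ∈ polyhedron H g ∧ 0 ≤ h x := by
  simp only [polyhedron, mem_ofPred_eq, and_assoc]
  rw [Function.forall_update_iff g fun _ f => 0 ≤ f x, and_comm (a := 0 ≤ h x)]
  refine and_congr_right fun _ => and_congr_left fun _ => ⟨fun hx a => ?_, fun hx a _ => hx a⟩
  by_cases ha : a = s
  · rw [ha, hs]
    exact zero_le_one
  · exact hx a ha

lemma active_update_eq_iff (hs : ∀ x, g s x = 1) :
    active (Function.update g s h) x = τ ↔ active g x = τ \ {s} ∧ (h x = 0 ↔ s ∈ τ) := by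
  simp only [active, Set.ext_iff, mem_ofPred_eq, Set.mem_sdiff, mem_singleton_iff]
  rw [Function.forall_update_iff g fun a f => f x = 0 ↔ a ∈ τ, and_comm]
  refine and_congr_left fun _ => forall_congr' fun a => ?_
  by_cases ha : a = s
  · simp [ha, hs]
  · simp [ha]

lemma mem_activeSets_update [FiniteDimensional ℝ E] [Finite A]
    (hQ : IsCompact (polyhedron H g)) (hs : ∀ x, g s x = 1) (hcut : CutsOff H g σ h) :
    τ ∈ activeSets H (Function.update g s h) ↔
      τ \ {s} ∈ activeSets H g ∧ ¬ σ ⊆ τ \ {s} ∧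
        (s ∈ τ → ∃ ρ ∈ activeSets H g, σ ∪ τ \ {s} ⊆ ρ) := by
  have hmem : τ ∈ activeSets H (Function.update g s h) ↔
      ∃ x ∈ polyhedron H g, active g x = τ \ {s} ∧ 0 ≤ h x ∧ (h x = 0 ↔ s ∈ τ) := by
    simp only [activeSets, mem_image, mem_polyhedron_update hs, active_update_eq_iff hs]
    exact exists_congr fun x => by tauto
  rw [hmem]
  constructor
  · rintro ⟨x, hx, hxτ, hpos, hsτ⟩
    rw [← hxτ]
    exact ⟨⟨x, hx, rfl⟩, fun hσ => (hcut.neg_of_mem_faceOf hQ ⟨hx, hσ⟩).not_ge hpos,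
      fun h => hcut.exists_superset_of_nonpos hQ hx (hsτ.2 h).le⟩
  · rintro ⟨⟨x, hx, hxτ⟩, hσ, hρ⟩
    rw [← hxτ] at hσ hρ ⊢
    by_cases hsτ : s ∈ τ
    · obtain ⟨ρ, hρ, hsub⟩ := hρ hsτ
      obtain ⟨y, hy, hyx, hy0⟩ := hcut.exists_eq_zero hQ hx hσ hρ hsub
      exact ⟨y, hy, hyx, hy0.ge, iff_of_true hy0 hsτ⟩
    · obtain ⟨y, hy, hyx, hpos⟩ := hcut.exists_pos hQ hx hσ
      exact ⟨y, hy, hyx, hpos.le, iff_of_false hpos.ne' hsτ⟩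

end CutsOff

end GraphAssoc

/-! ### The faces of graph associahedra -/

namespace GraphAssoc

open Set Filter Topology

section Nested

variable {ι : Type*} {τ ρ : Set (ι ⊕ Set ι)} {𝓛 : Set (Set ι)} {s t u : Set ι}

/-- The nodes `i ∈ t` that are marked by `inl i ∈ τ` or lie in a smaller set of nodes marked by
`inr u ∈ τ`. -/
def covered (τ : Set (ι ⊕ Set ι)) (t : Set ι) : Set ι :=
  {i | .inl i ∈ τ ∨ ∃ u, .inr u ∈ τ ∧ u ⊂ t ∧ i ∈ u}

/-- The active sets after truncating the simplex at the tubes in `𝓛`: the label `inl i` stands for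
the facet `x_i = 0` of the simplex, and `inr t` for the facet cut off at the tube `t`. -/
def Nested (𝓛 : Set (Set ι)) (τ : Set (ι ⊕ Set ι)) : Prop :=
  (∀ t, .inr t ∈ τ → t ∈ 𝓛) ∧ ∀ t ∈ insert univ 𝓛, ¬ t ⊆ covered τ t

lemma covered_mono (hτρ : τ ⊆ ρ) (htu : t ⊆ u) : covered τ t ⊆ covered ρ u := by
  rintro i (hi | ⟨v, hv, hvt, hi⟩)
  · exact .inl (hτρ hi)
  · exact .inr ⟨v, hτρ hv, hvt.trans_subset htu, hi⟩

lemma subset_covered (hu : .inr u ∈ τ) (hut : u ⊂ t) : u ⊆ covered τ t :=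
  fun _ hi => .inr ⟨u, hu, hut, hi⟩

lemma covered_image_inl_union_sdiff :
    covered (Sum.inl '' s ∪ τ \ {.inr s}) t ⊆ s ∪ covered τ t := by
  rintro i ((⟨j, hj, hji⟩ | hi) | ⟨u, ⟨_, _, hu⟩ | hu, hut, hi⟩)
  · cases hji
    exact .inl hj
  · exact .inr (.inl hi.1)
  · cases hu
  · exact .inr (.inr ⟨u, hu.1, hut, hi⟩)

lemma covered_subset_of_image_inl_union_sdiff (h : Sum.inl '' s ∪ τ \ {.inr s} ⊆ ρ) :
    covered τ t ⊆ covered ρ t := by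
  rintro i (hi | ⟨u, hu, hut, hi⟩)
  · exact .inl (h (.inr ⟨hi, by simp⟩))
  · by_cases hus : u = s
    · exact .inl (h (.inl ⟨i, hus ▸ hi, rfl⟩))
    · exact .inr ⟨u, h (.inr ⟨hu, by simpa using hus⟩), hut, hi⟩

namespace Nested

lemma mem_of_mem_sdiff (h : Nested (insert s 𝓛) τ) (ht : .inr t ∈ τ \ {.inr s}) : t ∈ 𝓛 :=
  (h.1 t ht.1).resolve_left fun hts => ht.2 (hts ▸ rfl)

lemma sdiff_singleton (h : Nested (insert s 𝓛) τ) : Nested 𝓛 (τ \ {.inr s}) :=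
  ⟨fun _ => h.mem_of_mem_sdiff, fun t ht hsub =>
    h.2 t (insert_subset_insert (subset_insert s 𝓛) ht)
      (hsub.trans (covered_mono sdiff_subset Subset.rfl))⟩

lemma not_image_inl_subset (h : Nested (insert s 𝓛) τ) : ¬ Sum.inl '' s ⊆ τ \ {.inr s} :=
  fun hsub => h.2 s (.inr (mem_insert s 𝓛)) fun i hi => .inl (hsub ⟨i, hi, rfl⟩).1

/-- If `s` and the nodes covered by `τ` together cover a set `t` that meets `s`, then `τ`, which
marks `s`, covers `t ∪ s`. -/
lemma image_inl_union_sdiff (h : Nested (insert s 𝓛) τ) (hsτ : .inr s ∈ τ)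
    (hs : ∀ t ∈ insert univ 𝓛, ¬ t ⊆ s)
    (hunion : ∀ t ∈ insert univ 𝓛, (t ∩ s).Nonempty → t ∪ s ∈ insert univ 𝓛) :
    Nested 𝓛 (Sum.inl '' s ∪ τ \ {.inr s}) := by
  refine ⟨?_, fun t ht hsub => ?_⟩
  · rintro t (⟨_, _, ht⟩ | ht)
    · cases ht
    · exact h.mem_of_mem_sdiff ht
  · have hmono : insert univ 𝓛 ⊆ insert univ (insert s 𝓛) :=
      insert_subset_insert (subset_insert s 𝓛)
    have hcov : t ⊆ s ∪ covered τ t := hsub.trans covered_image_inl_union_sdiff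
    by_cases hne : (t ∩ s).Nonempty
    · have hss : s ⊂ t ∪ s := subset_union_right.ssubset_of_not_subset
        fun hts => hs t ht (subset_union_left.trans hts)
      have hscov : s ⊆ covered τ (t ∪ s) := subset_covered hsτ hss
      exact h.2 _ (hmono (hunion t ht hne)) (union_subset (hcov.trans
        (union_subset hscov (covered_mono Subset.rfl subset_union_left))) hscov)
    · exact h.2 t (hmono ht) fun i hi => (hcov hi).resolve_left fun his => hne ⟨i, hi, his⟩

lemma of_sdiff_singleton (h : Nested 𝓛 (τ \ {.inr s})) (hns : ¬ Sum.inl '' s ⊆ τ \ {.inr s})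
    (hρ : .inr s ∈ τ → ∃ ρ, Nested 𝓛 ρ ∧ Sum.inl '' s ∪ τ \ {.inr s} ⊆ ρ)
    (hs : ∀ t ∈ insert univ 𝓛, ¬ t ⊆ s) : Nested (insert s 𝓛) τ := by
  have hmem (t : Set ι) (ht : .inr t ∈ τ) : t ∈ insert s 𝓛 := by
    by_cases hts : t = s
    · exact .inl hts
    · exact .inr (h.1 t ⟨ht, by simpa using hts⟩)
  have hold (t : Set ι) (ht : t ∈ insert univ 𝓛) : ¬ t ⊆ covered τ t := fun hsub => by
    by_cases hsτ : .inr s ∈ τ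
    · obtain ⟨ρ, hρ, hsubρ⟩ := hρ hsτ
      exact hρ.2 t ht (hsub.trans (covered_subset_of_image_inl_union_sdiff hsubρ))
    · rw [sdiff_singleton_eq_self hsτ] at h
      exact h.2 t ht hsub
  refine ⟨hmem, ?_⟩
  rintro t (rfl | rfl | ht)
  · exact hold univ (mem_insert univ 𝓛)
  · refine fun hsub => hns ?_
    rintro _ ⟨i, hi, rfl⟩
    rcases hsub hi with hi | ⟨u, hu, hus, -⟩
    · exact ⟨hi, by simp⟩
    · exact absurd hus.subset (hs u (.inr ((hmem u hu).resolve_left hus.ne)))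
  · exact hold t (.inr ht)

end Nested

lemma nested_insert_iff (hs : ∀ t ∈ insert univ 𝓛, ¬ t ⊆ s)
    (hunion : ∀ t ∈ insert univ 𝓛, (t ∩ s).Nonempty → t ∪ s ∈ insert univ 𝓛) :
    Nested (insert s 𝓛) τ ↔ Nested 𝓛 (τ \ {.inr s}) ∧ ¬ Sum.inl '' s ⊆ τ \ {.inr s} ∧
      (.inr s ∈ τ → ∃ ρ, Nested 𝓛 ρ ∧ Sum.inl '' s ∪ τ \ {.inr s} ⊆ ρ) :=
  ⟨fun h => ⟨h.sdiff_singleton, h.not_image_inl_subset,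
    fun hsτ => ⟨_, h.image_inl_union_sdiff hsτ hs hunion, Subset.rfl⟩⟩,
    fun h => h.1.of_sdiff_singleton h.2.1 h.2.2 hs⟩

lemma nested_empty_iff : Nested ∅ τ ↔ ∃ s ≠ univ, τ = Sum.inl '' s := by
  constructor
  · intro h
    refine ⟨Sum.inl ⁻¹' τ, fun huniv => h.2 univ (mem_insert univ ∅) fun i _ => .inl ?_, ?_⟩
    · exact (huniv ▸ mem_univ i : i ∈ Sum.inl ⁻¹' τ)
    · refine (image_preimage_eq_of_subset ?_).symm
      rintro (i | t) ha
      · exact mem_range_self i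
      · exact (h.1 t ha).elim
  · rintro ⟨s, hs, rfl⟩
    refine ⟨by simp, ?_⟩
    rintro t (rfl | ht) hsub
    · exact hs (univ_subset_iff.1 fun i hi => by simpa [covered] using hsub hi)
    · exact ht.elim

end Nested

section Tubings

variable {ι : Type*} {G : SimpleGraph ι} {τ : Set (ι ⊕ Set ι)} {t u : Set ι}

lemma mem_insert_univ_isTube_iff (hG : G.Connected) :
    t ∈ insert univ {t | IsTube G t} ↔ (G.induce t).Connected := by
  constructor
  · rintro (rfl | ht)
    · exact (SimpleGraph.induceUnivIso G).connected_iff.2 hG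
    · exact ht.2.2
  · intro ht
    by_cases huniv : t = univ
    · exact .inl huniv
    · exact .inr ⟨nonempty_of_connected ht, huniv, ht⟩

lemma not_subset_sUnion_of_compat (ht : (G.induce t).Connected) {𝓤 : Set (Set ι)}
    (hfin : 𝓤.Finite) (hconn : ∀ u ∈ 𝓤, (G.induce u).Connected) (hss : ∀ u ∈ 𝓤, u ⊂ t)
    (hcompat : 𝓤.Pairwise (Compat G)) : ¬ t ⊆ ⋃₀ 𝓤 := by
  intro hsub
  obtain ⟨i, hi⟩ := nonempty_of_connected ht
  obtain ⟨u, hu, -⟩ := hsub hi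
  obtain ⟨m, hm⟩ := hfin.exists_maximal ⟨u, hu⟩
  have hmt : (t ∩ m).Nonempty := by
    rw [inter_eq_right.2 (hss m hm.prop).subset]
    exact nonempty_of_connected (hconn m hm.prop)
  obtain ⟨a, ha, b, hb, hab⟩ := exists_adj_of_not_subset ht hmt (hss m hm.prop).not_subset
  obtain ⟨v, hv, hbv⟩ := hsub hb.1
  have hmv : m ≠ v := fun h => hb.2 (h ▸ hbv)
  rcases (compat_iff (hconn m hm.prop) (hconn v hv)).1 (hcompat hm.prop hv hmv)
    with hle | hle | hdisj
  · exact hmv (hm.eq_of_le hv hle)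
  · exact hb.2 (hle hbv)
  · exact hdisj.2 a ha.2 b hbv hab

lemma Nested.inl_notMem (hG : G.Connected) (h : Nested {t | IsTube G t} τ) (i : ι) :
    .inl i ∉ τ := fun hi =>
  h.2 {i} ((mem_insert_univ_isTube_iff hG).2 (connected_induce_singleton i))
    (singleton_subset_iff.2 (.inl hi))

lemma Nested.compat (hG : G.Connected) (h : Nested {t | IsTube G t} τ) (ht : .inr t ∈ τ)
    (hu : .inr u ∈ τ) : Compat G t u := by
  have hnested (hconn : (G.induce (t ∪ u)).Connected) : t ⊆ u ∨ u ⊆ t := by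
    by_contra! hnot
    refine h.2 _ ((mem_insert_univ_isTube_iff hG).2 hconn) (union_subset
      (subset_covered ht (subset_union_left.ssubset_of_not_subset fun hsub => ?_))
      (subset_covered hu (subset_union_right.ssubset_of_not_subset fun hsub => ?_)))
    · exact hnot.2 (subset_union_right.trans hsub)
    · exact hnot.1 (subset_union_left.trans hsub)
  refine ⟨fun hint => ?_, fun hadj => ?_⟩
  · rcases hnested (SimpleGraph.induce_union_connected (h.1 t ht).2.2.preconnected
      (h.1 u hu).2.2.preconnected hint.1) with hsub | hsub
    exacts [hint.2.1 hsub, hint.2.2 hsub]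
  · rcases hnested hadj.2 with hsub | hsub
    · exact (h.1 t ht).1.ne_empty (by rw [← hadj.1, inter_eq_left.2 hsub])
    · exact (h.1 u hu).1.ne_empty (by rw [← hadj.1, inter_eq_right.2 hsub])

lemma nested_image_inr [Finite ι] (hG : G.Connected) (T : Tubing G) :
    Nested {t | IsTube G t} (Sum.inr '' T.1) := by
  refine ⟨by simpa using T.2.1, fun t ht hsub => ?_⟩
  refine not_subset_sUnion_of_compat ((mem_insert_univ_isTube_iff hG).1 ht)
    (𝓤 := {u ∈ T.1 | u ⊂ t}) (Set.toFinite _) (fun u hu => (T.2.1 u hu.1).2.2)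
    (fun u hu => hu.2) (T.2.2.mono fun u hu => hu.1) fun i hi => ?_
  obtain ⟨u, huT, hut, hiu⟩ : ∃ u, u ∈ T.1 ∧ u ⊂ t ∧ i ∈ u := by
    simpa [covered] using hsub hi
  exact ⟨u, ⟨huT, hut⟩, hiu⟩

lemma nested_isTube_iff [Finite ι] (hG : G.Connected) :
    Nested {t | IsTube G t} τ ↔ ∃ T : Tubing G, Sum.inr '' T.1 = τ := by
  constructor
  · intro h
    refine ⟨⟨Sum.inr ⁻¹' τ, h.1, fun t ht u hu _ => h.compat hG ht hu⟩,
      image_preimage_eq_of_subset ?_⟩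
    rintro (i | t) ha
    · exact absurd ha (h.inl_notMem hG i)
    · exact mem_range_self t
  · rintro ⟨T, rfl⟩
    exact nested_image_inr hG T

end Tubings

section TruncationOrder

variable {ι : Type*} {G : SimpleGraph ι} {L : List (Set ι)} {s t : Set ι}

/-- `L` can be the list of the tubes that still have to be truncated at some stage of the
construction of a graph associahedron. -/
structure IsTruncationOrder (G : SimpleGraph ι) (L : List (Set ι)) : Prop where
  nodup : L.Nodup
  isTube : ∀ t ∈ L, IsTube G t
  pairwise : L.Pairwise fun t u => u.ncard ≤ t.ncard
  ncard_le : ∀ t, IsTube G t → t ∉ L → ∀ u ∈ L, u.ncard ≤ t.ncard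

/-- The tubes that have already been truncated when the tubes in `L` remain. -/
def truncated (G : SimpleGraph ι) (L : List (Set ι)) : Set (Set ι) := {t | IsTube G t ∧ t ∉ L}

lemma truncated_nil : truncated G [] = {t | IsTube G t} := by
  simp [truncated]

namespace IsTruncationOrder

lemma ncard_le_head (h : IsTruncationOrder G (s :: L)) (ht : t ∈ s :: L) : t.ncard ≤ s.ncard := by
  rcases List.mem_cons.1 ht with rfl | ht
  · exact le_rfl
  · exact (List.pairwise_cons.1 h.pairwise).1 t ht

lemma of_cons (h : IsTruncationOrder G (s :: L)) : IsTruncationOrder G L where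
  nodup := h.nodup.of_cons
  isTube t ht := h.isTube t (List.mem_cons_of_mem s ht)
  pairwise := h.pairwise.of_cons
  ncard_le t ht htL u hu := by
    by_cases hts : t = s
    · exact hts ▸ h.ncard_le_head (List.mem_cons_of_mem s hu)
    · exact h.ncard_le t ht (by simp [hts, htL]) u (List.mem_cons_of_mem s hu)

lemma truncated_eq_insert (h : IsTruncationOrder G (s :: L)) :
    truncated G L = insert s (truncated G (s :: L)) := by
  ext t
  simp only [truncated, mem_ofPred_eq, mem_insert_iff, List.mem_cons, not_or]
  by_cases hts : t = s
  · simp only [hts, h.isTube s List.mem_cons_self, (List.nodup_cons.1 h.nodup).1,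
      not_false_eq_true, and_self, true_or]
  · simp only [hts, not_false_eq_true, true_and, false_or]

lemma not_subset_head [Finite ι] (h : IsTruncationOrder G (s :: L))
    (ht : t ∈ insert univ (truncated G (s :: L))) : ¬ t ⊆ s := by
  rintro hts
  rcases ht with rfl | ⟨ht, htL⟩
  · exact (h.isTube s List.mem_cons_self).2.1 (univ_subset_iff.1 hts)
  · refine htL (List.mem_cons.2 (.inl ?_))
    exact eq_of_subset_of_ncard_le hts (h.ncard_le t ht htL s List.mem_cons_self)

lemma union_mem [Finite ι] (hG : G.Connected) (h : IsTruncationOrder G (s :: L))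
    (ht : t ∈ insert univ (truncated G (s :: L))) (hts : (t ∩ s).Nonempty) :
    t ∪ s ∈ insert univ (truncated G (s :: L)) := by
  have htconn : (G.induce t).Connected :=
    (mem_insert_univ_isTube_iff hG).1 (insert_subset_insert (fun _ hu => hu.1) ht)
  have hconn : (G.induce (t ∪ s)).Connected := SimpleGraph.induce_union_connected
    htconn.preconnected (h.isTube s List.mem_cons_self).2.2.preconnected hts
  refine ((mem_insert_univ_isTube_iff hG).2 hconn).imp_right fun htube => ⟨htube, fun hmem => ?_⟩
  have hss : s ⊂ t ∪ s := subset_union_right.ssubset_of_not_subset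
    fun hsub => h.not_subset_head ht (subset_union_left.trans hsub)
  exact (h.ncard_le_head hmem).not_gt (ncard_lt_ncard hss (Set.toFinite _))

end IsTruncationOrder

lemma isTruncationOrder_of_forall_mem_iff (hnd : L.Nodup) (hmem : ∀ t, t ∈ L ↔ IsTube G t)
    (hpw : L.Pairwise fun t u => u.ncard ≤ t.ncard) : IsTruncationOrder G L :=
  ⟨hnd, fun t => (hmem t).1, hpw, fun t ht htL => absurd ((hmem t).2 ht) htL⟩

lemma truncated_eq_empty (hmem : ∀ t, t ∈ L ↔ IsTube G t) : truncated G L = ∅ := by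
  simp [truncated, hmem]

end TruncationOrder

section Model

variable {ι : Type*} [Fintype ι] {G : SimpleGraph ι} {𝓛 : Set (Set ι)} {Q Q' : Set (ι → ℝ)}
  {g : ι ⊕ Set ι → (ι → ℝ) →ᵃ[ℝ] ℝ} {s : Set ι}

/-- The hyperplane `∑ x_i = 1`. -/
def simplexHyperplane (ι : Type*) [Fintype ι] : AffineSubspace ℝ (ι → ℝ) where
  carrier := {x | ∑ i, x i = 1}
  smul_vsub_vadd_mem' c x y z hx hy hz := by
    rw [mem_ofPred_eq] at hx hy hz
    simp [Finset.sum_add_distrib, ← Finset.mul_sum, Finset.sum_sub_distrib, hx, hy, hz]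

/-- `Q` is a truncation of the standard simplex, with one additional inequality for each tube in
`𝓛`, whose active sets are the nested sets of `𝓛`. -/
def IsModel (𝓛 : Set (Set ι)) (Q : Set (ι → ℝ)) : Prop :=
  ∃ g : ι ⊕ Set ι → (ι → ℝ) →ᵃ[ℝ] ℝ, (∀ i x, g (.inl i) x = x i) ∧
    (∀ t ∉ 𝓛, ∀ x, g (.inr t) x = 1) ∧ Q = polyhedron (simplexHyperplane ι) g ∧
    ∀ τ, τ ∈ activeSets (simplexHyperplane ι) g ↔ Nested 𝓛 τ

lemma isCompact_polyhedron_of_coord (hg : ∀ i x, g (.inl i) x = x i) :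
    IsCompact (polyhedron (simplexHyperplane ι) g) := by
  refine (isCompact_univ_pi fun _ : ι => isCompact_Icc (a := (0 : ℝ)) (b := 1)).of_isClosed_subset
    isClosed_polyhedron fun x hx i _ => ?_
  have hnonneg (i : ι) : 0 ≤ x i := (hx.2 (.inl i)).trans_eq (hg i x)
  exact ⟨hnonneg i, (Finset.single_le_sum (fun j _ => hnonneg j) (Finset.mem_univ i)).trans_eq hx.1⟩

lemma faceOf_image_inl (hg : ∀ i x, g (.inl i) x = x i) (s : Set ι) :
    faceOf (simplexHyperplane ι) g (Sum.inl '' s) =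
      {x ∈ polyhedron (simplexHyperplane ι) g | ∀ i ∈ s, x i = 0} := by
  simp only [faceOf, active, image_subset_iff, preimage_ofPred_eq, hg]
  rfl

lemma exists_mem_stdSimplex_eq_zero_iff (hs : s ≠ univ) :
    ∃ x ∈ stdSimplex ℝ ι, ∀ i, x i = 0 ↔ i ∈ s := by
  classical
  have hpos : 0 < (sᶜ.toFinset.card : ℝ) := by
    exact_mod_cast Finset.card_pos.2 (toFinset_nonempty.2 (nonempty_compl.2 hs))
  refine ⟨fun i => if i ∈ sᶜ.toFinset then (sᶜ.toFinset.card : ℝ)⁻¹ else 0, ⟨fun i => ?_, ?_⟩,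
    fun i => ?_⟩
  · positivity
  · rw [Finset.sum_ite_mem, Finset.univ_inter, Finset.sum_const, nsmul_eq_mul,
      mul_inv_cancel₀ hpos.ne']
  · by_cases hi : i ∈ s <;> simp [hi, hs]

lemma isModel_simplex : IsModel ∅ {x : ι → ℝ | (∀ i, 0 ≤ x i) ∧ ∑ᶠ i, x i = 1} := by
  let g : ι ⊕ Set ι → (ι → ℝ) →ᵃ[ℝ] ℝ :=
    Sum.elim (fun i => (LinearMap.proj i).toAffineMap) fun _ => AffineMap.const ℝ _ 1
  have hpoly : polyhedron (simplexHyperplane ι) g = stdSimplex ℝ ι := by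
    ext x
    exact ⟨fun hx => ⟨fun i => hx.2 (.inl i), hx.1⟩,
      fun hx => ⟨hx.2, Sum.forall.2 ⟨hx.1, fun _ => zero_le_one⟩⟩⟩
  have hactive (x : ι → ℝ) : active g x = Sum.inl '' {i | x i = 0} := by
    ext (i | t) <;> simp [active, g]
  refine ⟨g, fun _ _ => rfl, fun _ _ _ => rfl, ?_, fun τ => ?_⟩
  · simp only [hpoly, stdSimplex, finsum_eq_sum_of_fintype]
  · rw [nested_empty_iff, activeSets, hpoly]
    constructor
    · rintro ⟨x, hx, rfl⟩
      refine ⟨_, fun huniv => zero_ne_one (α := ℝ) ?_, hactive x⟩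
      rw [← hx.2, Finset.sum_eq_zero fun i _ => (huniv ▸ mem_univ i : i ∈ {i | x i = 0})]
    · rintro ⟨s, hs, rfl⟩
      obtain ⟨x, hx, hxs⟩ := exists_mem_stdSimplex_eq_zero_iff hs
      exact ⟨x, hx, by simp only [hactive, hxs, ofPred_mem_eq]⟩

lemma IsModel.truncation (h : IsModel 𝓛 Q) (hs𝓛 : s ∉ 𝓛) (hs : ∀ t ∈ insert univ 𝓛, ¬ t ⊆ s)
    (hunion : ∀ t ∈ insert univ 𝓛, (t ∩ s).Nonempty → t ∪ s ∈ insert univ 𝓛)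
    (hQ' : IsTruncation Q {x ∈ Q | ∀ i ∈ s, x i = 0} Q') : IsModel (insert s 𝓛) Q' := by
  classical
  obtain ⟨g, hg, hg𝓛, rfl, hact⟩ := h
  obtain ⟨l, c, hlt, hgt, rfl⟩ := hQ'
  let h := l.toAffineMap - AffineMap.const ℝ (ι → ℝ) c
  have hcut : CutsOff (simplexHyperplane ι) g (Sum.inl '' s) h := by
    rw [CutsOff, faceOf_image_inl hg]
    exact ⟨fun x hx hxs => sub_neg.2 (hlt x hx hxs), fun x hx hxs => sub_pos.2 (hgt x hx hxs)⟩
  refine ⟨Function.update g (.inr s) h, fun i x => ?_, fun t ht x => ?_, ?_, fun τ => ?_⟩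
  · rw [Function.update_of_ne (by simp), hg]
  · rw [mem_insert_iff, not_or] at ht
    rw [Function.update_of_ne (by simpa using ht.1), hg𝓛 t ht.2]
  · ext x
    rw [mem_polyhedron_update (hg𝓛 s hs𝓛), mem_ofPred_eq, ← sub_nonneg (b := c)]
    rfl
  · rw [mem_activeSets_update (isCompact_polyhedron_of_coord hg) (hg𝓛 s hs𝓛) hcut,
      nested_insert_iff hs hunion]
    simp only [hact]

lemma exists_pos_forall_lt {α : Type*} {S : Set α} (hS : S.Finite) (f : α → ℝ) :
    ∃ c > 0, ∀ x ∈ S, 0 < f x → c < f x := by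
  have hev : ∀ᶠ c in 𝓝[>] (0 : ℝ), ∀ x ∈ S, 0 < f x → c < f x :=
    hS.eventually_all.2 fun x _ => eventually_imp_distrib_left.2 fun hx =>
      (gt_mem_nhds hx).filter_mono nhdsWithin_le_nhds
  obtain ⟨c, hc, hc0⟩ := (hev.and self_mem_nhdsWithin).exists
  exact ⟨c, hc0, hc⟩

lemma IsModel.exists_isTruncation (h : IsModel 𝓛 Q) (s : Set ι) :
    ∃ Q', IsTruncation Q {x ∈ Q | ∀ i ∈ s, x i = 0} Q' := by
  classical
  obtain ⟨g, hg, -, rfl, -⟩ := h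
  have hnonneg {x : ι → ℝ} (hx : x ∈ polyhedron (simplexHyperplane ι) g) (i : ι) : 0 ≤ x i :=
    (hx.2 (.inl i)).trans_eq (hg i x)
  obtain ⟨c, hc0, hc⟩ := exists_pos_forall_lt (finite_extremePoints (H := simplexHyperplane ι)
    (g := g)) fun x => ∑ i ∈ s.toFinset, x i
  refine ⟨_, ∑ i ∈ s.toFinset, LinearMap.proj i, c, fun x _ hxs => ?_, fun x hx hxs => ?_, rfl⟩
  · simpa [Finset.sum_eq_zero fun i hi => hxs.2 i (mem_toFinset.1 hi)] using hc0
  · obtain ⟨i, hi, hxi⟩ : ∃ i ∈ s, x i ≠ 0 := by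
      simpa [extremePoints_subset hx] using hxs
    rw [LinearMap.sum_apply]
    exact hc x hx (Finset.sum_pos' (fun j _ => hnonneg hx.1 j)
      ⟨i, mem_toFinset.2 hi, (hnonneg hx.1 i).lt_of_ne' hxi⟩)

section IteratedTruncation

variable {L : List (Set ι)}

lemma IsModel.truncation_head (hG : G.Connected) (hL : IsTruncationOrder G (s :: L))
    (hQ : IsModel (truncated G (s :: L)) Q)
    (hQ' : IsTruncation Q {x ∈ Q | ∀ i ∈ s, x i = 0} Q') : IsModel (truncated G L) Q' := by
  rw [hL.truncated_eq_insert]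
  exact hQ.truncation (fun hs => hs.2 List.mem_cons_self) (fun _ => hL.not_subset_head)
    (fun _ => hL.union_mem hG) hQ'

lemma IsModel.exists_isIteratedTruncation (hG : G.Connected) (hL : IsTruncationOrder G L)
    (hQ : IsModel (truncated G L) Q) : ∃ P, IsIteratedTruncation Q L P := by
  induction L generalizing Q with
  | nil => exact ⟨Q, .nil Q⟩
  | cons s L ih =>
    obtain ⟨Q', hQ'⟩ := hQ.exists_isTruncation s
    obtain ⟨P, hP⟩ := ih hL.of_cons (hQ.truncation_head hG hL hQ')
    exact ⟨P, .cons Q Q' P s L hQ' hP⟩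

lemma IsModel.isIteratedTruncation (hG : G.Connected) (hL : IsTruncationOrder G L)
    (hQ : IsModel (truncated G L) Q) {P : Set (ι → ℝ)} (hP : IsIteratedTruncation Q L P) :
    IsModel {t | IsTube G t} P := by
  induction hP with
  | nil Q => rwa [truncated_nil] at hQ
  | cons Q Q' _ s L hQ' _ ih => exact ih hL.of_cons (hQ.truncation_head hG hL hQ')

end IteratedTruncation

lemma IsModel.nonempty_orderIso (hG : G.Connected) (hQ : IsModel {t | IsTube G t} Q) :
    Nonempty (Tubing G ≃o (Face Q)ᵒᵈ) := by
  obtain ⟨g, -, -, rfl, hact⟩ := hQ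
  have hmem (τ : Set (ι ⊕ Set ι)) : τ ∈ activeSets (simplexHyperplane ι) g ↔
      ∃ T : Tubing G, Sum.inr '' T.1 = τ := (hact τ).trans (nested_isTube_iff hG)
  let e : Tubing G ≃o activeSets (simplexHyperplane ι) g := OrderIso.ofSurjective
    (OrderEmbedding.ofMapLEIff (fun T => ⟨Sum.inr '' T.1, (hmem _).2 ⟨T, rfl⟩⟩)
      fun _ _ => image_subset_image_iff Sum.inr_injective)
    fun τ => ((hmem τ).1 τ.2).imp fun _ => Subtype.ext
  exact ⟨e.trans activeSetsOrderIsoFace⟩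

end Model

section GraphAssociahedron

variable {ι : Type*} [Finite ι] {G : SimpleGraph ι}

lemma exists_list_tubes_pairwise_ncard_le (G : SimpleGraph ι) : ∃ L : List (Set ι),
    L.Nodup ∧ (∀ t, t ∈ L ↔ IsTube G t) ∧ L.Pairwise fun t u => u.ncard ≤ t.ncard := by
  let L := (Set.toFinite {t | IsTube G t}).toFinset.toList
  have hperm := L.mergeSort_perm fun t u => decide (u.ncard ≤ t.ncard)
  refine ⟨_, hperm.nodup_iff.2 (Finset.nodup_toList _), fun t => ?_, ?_⟩
  · simp [hperm.mem_iff, L]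
  · simpa using List.pairwise_mergeSort (le := fun t u : Set ι => decide (u.ncard ≤ t.ncard))
      (fun _ _ _ => by simpa using fun h h' => le_trans h' h)
      (fun _ _ => by simpa using le_total _ _) L

theorem exists_isGraphAssociahedron (hG : G.Connected) : ∃ P, IsGraphAssociahedron G P := by
  have := Fintype.ofFinite ι
  obtain ⟨L, hnd, hmem, hpw⟩ := exists_list_tubes_pairwise_ncard_le G
  obtain ⟨P, hP⟩ := IsModel.exists_isIteratedTruncation hG
    (isTruncationOrder_of_forall_mem_iff hnd hmem hpw)
    ((truncated_eq_empty hmem).symm ▸ isModel_simplex)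
  exact ⟨P, L, hnd, hmem, hpw, hP⟩

theorem IsGraphAssociahedron.nonempty_orderIso (hG : G.Connected) {P : Set (ι → ℝ)}
    (hP : IsGraphAssociahedron G P) : Nonempty (Tubing G ≃o (Face P)ᵒᵈ) := by
  have := Fintype.ofFinite ι
  obtain ⟨L, hnd, hmem, hpw, hP⟩ := hP
  exact (IsModel.isIteratedTruncation hG (isTruncationOrder_of_forall_mem_iff hnd hmem hpw)
    ((truncated_eq_empty hmem).symm ▸ isModel_simplex) hP).nonempty_orderIso hG

end GraphAssociahedron

/-! ### Faces of products -/

section Product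

variable {κ : Type*} {E : κ → Type*} [∀ k, AddCommGroup (E k)] [∀ k, Module ℝ (E k)]
  [∀ k, TopologicalSpace (E k)] {P F : ∀ k, Set (E k)}

lemma toExposed_univ_pi [Fintype κ] (l : ∀ k, StrongDual ℝ (E k))
    (hne : ∀ k, ((l k).toExposed (P k)).Nonempty) :
    (∑ k, (l k).comp (ContinuousLinearMap.proj k)).toExposed (univ.pi P) =
      univ.pi fun k => (l k).toExposed (P k) := by
  choose m hm hmax using hne
  have hsum (x : ∀ k, E k) : (∑ k, (l k).comp (ContinuousLinearMap.proj k) : StrongDual ℝ _) x =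
      ∑ k, l k (x k) := by simp
  ext x
  simp only [ContinuousLinearMap.toExposed, mem_univ_pi, mem_ofPred_eq, hsum]
  constructor
  · rintro ⟨hx, hxmax⟩ k
    have hle (k : κ) : l k (x k) ≤ l k (m k) := hmax k _ (hx k)
    have heq := (Finset.sum_eq_sum_iff_of_le fun k _ => hle k).1
      ((Finset.sum_le_sum fun k _ => hle k).antisymm (hxmax m hm)) k (Finset.mem_univ k)
    exact ⟨hx k, fun y hy => heq ▸ hmax k y hy⟩
  · exact fun hx => ⟨fun k => (hx k).1, fun y hy => Finset.sum_le_sum fun k _ => (hx k).2 _ (hy k)⟩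

variable [Finite κ]

lemma isExposed_univ_pi (hne : ∀ k, (F k).Nonempty) (hF : ∀ k, IsExposed ℝ (P k) (F k)) :
    IsExposed ℝ (univ.pi P) (univ.pi F) := by
  have := Fintype.ofFinite κ
  choose l hl using fun k => hF k (hne k)
  obtain rfl : F = fun k => (l k).toExposed (P k) := funext hl
  rw [← toExposed_univ_pi l hne]
  exact ContinuousLinearMap.toExposed.isExposed

lemma exists_univ_pi_eq_of_isExposed {K : Set (∀ k, E k)} (hne : K.Nonempty)
    (hK : IsExposed ℝ (univ.pi P) K) :
    ∃ F : ∀ k, Set (E k), (∀ k, (F k).Nonempty) ∧ (∀ k, IsExposed ℝ (P k) (F k)) ∧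
      univ.pi F = K := by
  classical
  have := Fintype.ofFinite κ
  obtain ⟨l, rfl⟩ := hK hne
  obtain ⟨x, hx, hmax⟩ := hne
  let l' (k : κ) : StrongDual ℝ (E k) := l.comp (ContinuousLinearMap.single ℝ E k)
  have hl : l = ∑ k, (l' k).comp (ContinuousLinearMap.proj k) := by
    ext y
    conv_lhs => rw [← Finset.univ_sum_single y]
    simp [l']
  have hne (k : κ) : ((l' k).toExposed (P k)).Nonempty := by
    refine ⟨x k, hx k (mem_univ k), fun y hy => ?_⟩
    have hle := hmax (Function.update x k y) (update_mem_pi_iff_of_mem hx |>.2 fun _ => hy)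
    have hsingle : Function.update x k y - x = Pi.single k (y - x k) := by
      ext j
      obtain rfl | hj := eq_or_ne j k <;> simp [*]
    rw [← sub_nonpos, ← map_sub, hsingle] at hle
    rwa [← sub_nonpos, ← map_sub]
  refine ⟨_, hne, fun k => ContinuousLinearMap.toExposed.isExposed, ?_⟩
  rw [← toExposed_univ_pi l' hne, ← hl]
  rfl

/-- The face poset of a product is the product of the face posets. -/
noncomputable def facePiOrderIso (P : ∀ k, Set (E k)) :
    (∀ k, (Face (P k))ᵒᵈ) ≃o (Face (univ.pi P))ᵒᵈ :=
  OrderIso.ofSurjective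
    (OrderEmbedding.ofMapLEIff
      (fun F => OrderDual.toDual ⟨univ.pi fun k => (F k).ofDual.1,
        univ_pi_nonempty_iff.2 fun k => (F k).ofDual.2.1,
        isExposed_univ_pi (fun k => (F k).ofDual.2.1) fun k => (F k).ofDual.2.2⟩)
      fun F F' => univ_pi_subset_univ_pi_iff.trans
        (or_iff_left fun ⟨k, hk⟩ => (F' k).ofDual.2.1.ne_empty hk))
    fun K => by
      obtain ⟨F, hne, hexp, hF⟩ := exists_univ_pi_eq_of_isExposed K.ofDual.2.1 K.ofDual.2.2
      exact ⟨fun k => OrderDual.toDual ⟨F k, hne k, hexp k⟩, Subtype.ext hF⟩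

end Product

end GraphAssoc

/-! ### Positive roots and their supports -/

namespace Bergman

open Set Function CoxeterMatrix CoxeterSystem GraphAssoc

lemma simpleRoot_self {B : Type*} [DecidableEq B] (i : B) : simpleRoot i i = 1 :=
  Pi.single_eq_same i 1

lemma simpleRoot_of_ne {B : Type*} [DecidableEq B] {i j : B} (h : j ≠ i) : simpleRoot i j = 0 :=
  Pi.single_eq_of_ne h 1

lemma simpleRoot_nonneg {B : Type*} [DecidableEq B] (i : B) : 0 ≤ simpleRoot i :=
  Pi.single_nonneg.2 zero_le_one

section Form

variable {B : Type*} (M : CoxeterMatrix B)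

lemma cos_nonneg {i j : B} (hij : i ≠ j) : 0 ≤ Real.cos (Real.pi / M i j) := by
  have h1 := M.off_diagonal i j hij
  rcases Nat.eq_zero_or_pos (M i j) with h0 | hpos
  · simp [h0]
  have h2 : (2 : ℝ) ≤ M i j := by exact_mod_cast (show 2 ≤ M i j by omega)
  exact Real.cos_nonneg_of_neg_pi_div_two_le_of_le
    (by linarith [Real.pi_pos, show 0 ≤ Real.pi / M i j by positivity])
    (div_le_div_of_nonneg_left Real.pi_pos.le two_pos h2)

lemma cos_pos_iff_adj {i j : B} (hij : i ≠ j) :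
    0 < Real.cos (Real.pi / M i j) ↔ M.diagram.Adj i j := by
  constructor
  · contrapose!
    intro h
    have h1 := M.off_diagonal i j hij
    have h2 : M i j = 2 := by
      have h3 : ¬ (M i j = 0 ∨ 3 ≤ M i j) := fun h' => h ⟨hij, h'⟩
      omega
    rw [h2, Nat.cast_ofNat, Real.cos_pi_div_two]
  · rintro ⟨-, h | h⟩
    · simp [h]
    · have h3 : (2 : ℝ) < M i j := by exact_mod_cast h
      exact Real.cos_pos_of_mem_Ioo
        ⟨by linarith [Real.pi_pos, show 0 ≤ Real.pi / M i j by positivity],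
          div_lt_div_of_pos_left Real.pi_pos two_pos h3⟩

variable [Fintype B] [DecidableEq B]

lemma form_simpleRoot_right (v : B → ℝ) (j : B) :
    M.form v (simpleRoot j) = -∑ i, v i * Real.cos (Real.pi / M i j) := by
  simp [form, simpleRoot, Matrix.toBilin'_apply, Pi.single_apply]

lemma form_simpleRoot_neg_iff {v : B → ℝ} (hv : 0 ≤ v) {j : B} (hj : v j = 0) :
    M.form v (simpleRoot j) < 0 ↔ ∃ i ∈ support v, M.diagram.Adj i j := by
  have hne {i : B} (hi : i ∈ support v) : i ≠ j := by
    rintro rfl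
    exact hi hj
  have hnonneg (i : B) : 0 ≤ v i * Real.cos (Real.pi / M i j) := by
    by_cases hi : i ∈ support v
    · exact mul_nonneg (hv i) (cos_nonneg M (hne hi))
    · rw [notMem_support.1 hi, zero_mul]
  rw [form_simpleRoot_right, neg_neg_iff_pos, Finset.sum_pos_iff_of_nonneg fun i _ => hnonneg i]
  simp only [Finset.mem_univ, true_and]
  refine exists_congr fun i => ⟨fun h => ?_, fun ⟨hi, hadj⟩ => ?_⟩
  · have hi : i ∈ support v := left_ne_zero_of_mul h.ne'
    exact ⟨hi, (cos_pos_iff_adj M (hne hi)).1 (pos_of_mul_pos_right h (hv i))⟩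
  · exact mul_pos ((hv i).lt_of_ne' hi) ((cos_pos_iff_adj M (hne hi)).2 hadj)

lemma simpleReflection_apply_self (j : B) (v : B → ℝ) :
    M.simpleReflection j v j = v j - 2 * M.form v (simpleRoot j) := by
  simp [simpleReflection_apply, simpleRoot_self]

lemma simpleReflection_apply_of_ne {i j : B} (h : j ≠ i) (v : B → ℝ) :
    M.simpleReflection i v j = v j := by
  simp [simpleReflection_apply, simpleRoot_of_ne h]

lemma simpleReflection_simpleReflection (i : B) (v : B → ℝ) :
    M.simpleReflection i (M.simpleReflection i v) = v :=
  Module.involutive_reflection (M.two_smul_form_self i) v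

lemma simpleReflection_simpleRoot_self (i : B) :
    M.simpleReflection i (simpleRoot i) = -simpleRoot i :=
  Module.reflection_apply_self (M.two_smul_form_self i)

lemma simpleReflection_simpleRoot (i j : B) : M.simpleReflection i (simpleRoot j) =
    simpleRoot j + (2 * Real.cos (Real.pi / M i j)) • simpleRoot i := by
  rw [simpleReflection_apply, form_simpleRoot, M.symmetric j i]
  module

lemma form_simpleReflection_simpleRoot (j : B) (v : B → ℝ) :
    M.form (M.simpleReflection j v) (simpleRoot j) = -M.form v (simpleRoot j) := by
  have h : M.form (simpleRoot j) (simpleRoot j) = 1 := by simp [form_simpleRoot]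
  rw [simpleReflection_apply, map_sub, map_smul, LinearMap.sub_apply, LinearMap.smul_apply, h,
    smul_eq_mul]
  ring

lemma support_simpleReflection {j : B} {v : B → ℝ} (h : M.simpleReflection j v j ≠ 0) :
    support (M.simpleReflection j v) = insert j (support v) := by
  ext i
  by_cases hi : i = j
  · subst hi
    simpa using h
  · simp [simpleReflection_apply_of_ne M hi, hi]

lemma simpleReflection_apply_self_pos {j : B} {v : B → ℝ} (hv : 0 ≤ v) (hj : v j = 0)
    (hadj : ∃ i ∈ support v, M.diagram.Adj i j) : 0 < M.simpleReflection j v j := by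
  have := (form_simpleRoot_neg_iff M hv hj).2 hadj
  rw [simpleReflection_apply_self]
  linarith

lemma connected_support_of_simpleReflection {j : B} {v : B → ℝ}
    (hform : 0 < M.form v (simpleRoot j)) (hs : 0 ≤ M.simpleReflection j v)
    (hconn : (M.diagram.induce (support (M.simpleReflection j v))).Connected) :
    (M.diagram.induce (support v)).Connected := by
  set u := M.simpleReflection j v with hu
  have hvu : v = M.simpleReflection j u := (simpleReflection_simpleReflection M j v).symm
  have huform : M.form u (simpleRoot j) < 0 := by
    rwa [hu, form_simpleReflection_simpleRoot, neg_neg_iff_pos]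
  have huj : 0 ≤ u j := hs j
  rw [hvu, support_simpleReflection M (by rw [simpleReflection_apply_self]; linarith)]
  by_cases hj : j ∈ support u
  · rwa [insert_eq_of_mem hj]
  · obtain ⟨i, hi, hadj⟩ := (form_simpleRoot_neg_iff M hs (notMem_support.1 hj)).1 huform
    have hij : insert j (support u) = support u ∪ {i, j} := by
      rw [union_insert, union_singleton, Set.insert_comm, insert_eq_of_mem hi]
    rw [hij]
    exact M.diagram.induce_union_connected hconn.preconnected
      (SimpleGraph.induce_pair_connected_of_adj hadj).preconnected ⟨i, hi, mem_insert _ _⟩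

lemma support_eq_singleton_of_simpleReflection_nonpos {j : B} {v : B → ℝ} (hv0 : v ≠ 0)
    (hv : 0 ≤ v) (hs : M.simpleReflection j v ≤ 0) : support v = {j} := by
  have hsub : support v ⊆ {j} := fun i hi => by
    by_contra hij
    exact hi (((simpleReflection_apply_of_ne M hij v).symm.trans_le (hs i)).antisymm (hv i))
  exact (subset_singleton_iff_eq.1 hsub).resolve_left (support_nonempty_iff.2 hv0).ne_empty

end Form

section Roots

variable {B W : Type*} [Group W] {M : CoxeterMatrix B} (cs : CoxeterSystem M W)

/- The element `v` is the shortest one of the coset `w ⟨s, t⟩`. -/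
lemma exists_eq_mul_alternatingWord {w : W} {s : B} (hs : ¬ cs.IsRightDescent w s) (t : B) :
    ∃ (m : ℕ) (v : W), w = v * cs.wordProd (alternatingWord s t m) ∧
      cs.length v + m = cs.length w ∧ ¬ cs.IsRightDescent v s ∧ ¬ cs.IsRightDescent v t := by
  induction hn : cs.length w generalizing w s t with
  | zero =>
    obtain rfl := cs.length_eq_zero_iff.1 hn
    exact ⟨0, 1, by simp [alternatingWord], by simp, cs.not_isRightDescent_one s,
      cs.not_isRightDescent_one t⟩
  | succ n ih =>
    by_cases ht : cs.IsRightDescent w t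
    · obtain ⟨m, v, hv, hlen, hvt, hvs⟩ := ih
        (cs.isRightDescent_iff_not_isRightDescent_mul.1 ht) s
        (by have := cs.isRightDescent_iff.1 ht; omega)
      refine ⟨m + 1, v, ?_, by omega, hvs, hvt⟩
      rw [alternatingWord_succ, wordProd_concat, ← mul_assoc, ← hv,
        simple_mul_simple_cancel_right]
    · exact ⟨0, w, by simp [alternatingWord], by simpa using hn, hs, ht⟩

lemma eq_zero_or_lt_of_length_mul_alternatingWord {w v : W} {s t : B} {m : ℕ}
    (hs : ¬ cs.IsRightDescent w s) (hw : w = v * cs.wordProd (alternatingWord s t m))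
    (hlen : cs.length v + m = cs.length w) : M s t = 0 ∨ m < M s t := by
  by_contra! hcon
  refine cs.not_isReduced_alternatingWord t s (m := m + 1) (M.symmetric t s ▸ hcon.1)
    (by rw [M.symmetric]; omega) ?_
  have hws : w * cs.simple s = v * cs.wordProd (alternatingWord t s (m + 1)) := by
    rw [alternatingWord_succ, wordProd_concat, ← mul_assoc, ← hw]
  have hmul := cs.length_mul_le v (cs.wordProd (alternatingWord t s (m + 1)))
  have hword := cs.length_wordProd_le (alternatingWord t s (m + 1))
  rw [← hws, cs.not_isRightDescent_iff.1 hs] at hmul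
  rw [length_alternatingWord] at hword
  rw [CoxeterSystem.IsReduced, length_alternatingWord]
  omega

lemma eval_chebyshev_U_cos_nonneg {m k : ℕ} (hm : m ≠ 1) (hk : m = 0 ∨ k ≤ m) :
    0 ≤ (Polynomial.Chebyshev.U ℝ (k - 1)).eval (Real.cos (Real.pi / m)) := by
  rcases Nat.eq_zero_or_pos m with rfl | hpos
  · simp
  have hm2 : (1 : ℝ) < m := by exact_mod_cast (show 1 < m by omega)
  have hkm : (k : ℝ) ≤ m := by exact_mod_cast hk.resolve_left hpos.ne'
  have hsin : 0 < Real.sin (Real.pi / m) :=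
    Real.sin_pos_of_pos_of_lt_pi (by positivity) (div_lt_self Real.pi_pos hm2)
  refine nonneg_of_mul_nonneg_left ?_ hsin
  rw [Polynomial.Chebyshev.U_real_cos]
  refine Real.sin_nonneg_of_nonneg_of_le_pi (by push_cast; rw [sub_add_cancel]; positivity) ?_
  push_cast
  rw [sub_add_cancel, ← mul_div_assoc, div_le_iff₀ (by positivity), mul_comm]
  exact mul_le_mul_of_nonneg_left hkm Real.pi_pos.le

variable [Fintype B] [DecidableEq B]

lemma geomRep_simple (i : B) : cs.geomRep (cs.simple i) = M.simpleReflection i :=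
  cs.lift_apply_simple M.isLiftable_simpleReflection i

lemma geomRep_mul_apply (w w' : W) (v : B → ℝ) :
    cs.geomRep (w * w') v = cs.geomRep w (cs.geomRep w' v) := by
  rw [map_mul, LinearEquiv.mul_apply]

lemma geomRep_mul_simple_simpleRoot (w : W) (i : B) :
    cs.geomRep (w * cs.simple i) (simpleRoot i) = -cs.geomRep w (simpleRoot i) := by
  rw [geomRep_mul_apply, geomRep_simple, simpleReflection_simpleRoot_self, map_neg]

lemma geomRep_alternatingWord (s t : B) (m : ℕ) :
    cs.geomRep (cs.wordProd (alternatingWord s t m)) (simpleRoot s) =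
      (Polynomial.Chebyshev.U ℝ m).eval (Real.cos (Real.pi / M s t)) •
          simpleRoot (if Even m then s else t) +
        (Polynomial.Chebyshev.U ℝ (m - 1)).eval (Real.cos (Real.pi / M s t)) •
          simpleRoot (if Even m then t else s) := by
  induction m with
  | zero => simp [alternatingWord]
  | succ m ih =>
    have hU := congrArg (Polynomial.eval (Real.cos (Real.pi / M s t)))
      (Polynomial.Chebyshev.U_add_one ℝ m)
    simp only [Polynomial.eval_sub, Polynomial.eval_mul, Polynomial.eval_ofNat,
      Polynomial.eval_X] at hU
    rw [alternatingWord_succ', wordProd_cons, geomRep_mul_apply, ih, geomRep_simple,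
      Nat.cast_succ, hU, add_sub_cancel_right]
    by_cases hm : Even m <;>
    · simp only [hm, Nat.even_add_one, not_true, not_false_iff, if_true, if_false, map_add,
        map_smul, simpleReflection_simpleRoot_self, simpleReflection_simpleRoot M s t,
        simpleReflection_simpleRoot M t s, M.symmetric t s]
      module

lemma exists_nonneg_geomRep_alternatingWord_eq {s t : B} (hst : s ≠ t) {m : ℕ}
    (hm : M s t = 0 ∨ m < M s t) : ∃ a b : ℝ, 0 ≤ a ∧ 0 ≤ b ∧
      cs.geomRep (cs.wordProd (alternatingWord s t m)) (simpleRoot s) =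
        a • simpleRoot s + b • simpleRoot t := by
  have h1 := M.off_diagonal s t hst
  have ha := eval_chebyshev_U_cos_nonneg h1 (k := m + 1) hm
  have hb := eval_chebyshev_U_cos_nonneg h1 (hm.imp_right le_of_lt)
  rw [Nat.cast_succ, add_sub_cancel_right] at ha
  rw [geomRep_alternatingWord]
  split_ifs
  · exact ⟨_, _, ha, hb, rfl⟩
  · exact ⟨_, _, hb, ha, add_comm _ _⟩

theorem geomRep_simpleRoot_nonneg {w : W} {s : B} (hs : ¬ cs.IsRightDescent w s) :
    0 ≤ cs.geomRep w (simpleRoot s) := by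
  induction hn : cs.length w using Nat.strong_induction_on generalizing w s with
  | _ n ih =>
  by_cases hw : w = 1
  · rw [hw, map_one]
    exact simpleRoot_nonneg s
  obtain ⟨t, ht⟩ := cs.exists_rightDescent_of_ne_one hw
  have hst : s ≠ t := fun h => hs (h ▸ ht)
  obtain ⟨m, v, hv, hlen, hvs, hvt⟩ := exists_eq_mul_alternatingWord cs hs t
  have hm : m ≠ 0 := by
    rintro rfl
    rw [show w = v by simpa [alternatingWord] using hv] at ht
    exact hvt ht
  obtain ⟨a, b, ha, hb, hab⟩ := exists_nonneg_geomRep_alternatingWord_eq cs hst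
    (eq_zero_or_lt_of_length_mul_alternatingWord cs hs hv hlen)
  rw [hv, geomRep_mul_apply, hab, map_add, map_smul, map_smul]
  exact add_nonneg (smul_nonneg ha (ih (cs.length v) (by omega) hvs rfl))
    (smul_nonneg hb (ih (cs.length v) (by omega) hvt rfl))

theorem roots_nonneg_or_nonpos {β : B → ℝ} (hβ : β ∈ cs.roots) : 0 ≤ β ∨ β ≤ 0 := by
  obtain ⟨w, i, rfl⟩ := hβ
  by_cases h : cs.IsRightDescent w i
  · rw [isRightDescent_iff_not_isRightDescent_mul] at h
    have := geomRep_simpleRoot_nonneg cs h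
    rw [geomRep_mul_simple_simpleRoot, Left.nonneg_neg_iff] at this
    exact .inr this
  · exact .inl (geomRep_simpleRoot_nonneg cs h)

lemma simpleReflection_mem_roots (i : B) {β : B → ℝ} (hβ : β ∈ cs.roots) :
    M.simpleReflection i β ∈ cs.roots := by
  obtain ⟨w, k, rfl⟩ := hβ
  exact ⟨cs.simple i * w, k, by rw [geomRep_mul_apply, geomRep_simple]⟩

lemma simpleRoot_mem_posRoots (i : B) : simpleRoot i ∈ cs.posRoots :=
  ⟨⟨1, i, by rw [map_one, LinearEquiv.coe_one, id_eq]⟩, simpleRoot_nonneg i⟩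

lemma ne_zero_of_mem_roots {β : B → ℝ} (hβ : β ∈ cs.roots) : β ≠ 0 := by
  obtain ⟨w, i, rfl⟩ := hβ
  rw [ne_eq, LinearEquiv.map_eq_zero_iff]
  exact Pi.single_ne_zero_iff.2 one_ne_zero

/- Peeling the last letter `j` off `w` keeps `β` as long as `(β, α_j) ≤ 0`, and otherwise lets one
pass to the reflected root. -/
lemma connected_support_of_geomRep_nonpos {β : B → ℝ} (hβ : β ∈ cs.roots) (h0 : 0 ≤ β) {w : W}
    (hw : cs.geomRep w β ≤ 0) : (M.diagram.induce (support β)).Connected := by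
  induction hn : cs.length w using Nat.strong_induction_on generalizing w β with
  | _ n ih =>
  have hβ0 := ne_zero_of_mem_roots cs hβ
  have hw1 : w ≠ 1 := by
    rintro rfl
    exact hβ0 (le_antisymm (by simpa using hw) h0)
  obtain ⟨j, hj⟩ := cs.exists_rightDescent_of_ne_one hw1
  obtain ⟨u, rfl⟩ : ∃ u, w = u * cs.simple j :=
    ⟨w * cs.simple j, (cs.simple_mul_simple_cancel_right j).symm⟩
  rw [isRightDescent_iff_not_isRightDescent_mul, simple_mul_simple_cancel_right] at hj
  have hlen : cs.length u < n := by
    rw [← hn, cs.not_isRightDescent_iff.1 hj]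
    exact Nat.lt_succ_self _
  rw [geomRep_mul_apply, geomRep_simple] at hw
  rcases le_or_gt (M.form β (simpleRoot j)) 0 with hform | hform
  · refine ih _ hlen hβ h0 (w := u) ?_ rfl
    rw [simpleReflection_apply, map_sub, map_smul, sub_nonpos] at hw
    exact hw.trans (smul_nonpos_of_nonpos_of_nonneg (by linarith)
      (geomRep_simpleRoot_nonneg cs hj))
  have hβ' := simpleReflection_mem_roots cs j hβ
  rcases roots_nonneg_or_nonpos cs hβ' with h | h
  · exact connected_support_of_simpleReflection M hform h (ih _ hlen hβ' h hw rfl)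
  · rw [support_eq_singleton_of_simpleReflection_nonpos M hβ0 h0 h]
    exact connected_induce_singleton j

theorem connected_support_of_mem_posRoots {β : B → ℝ} (hβ : β ∈ cs.posRoots) :
    (M.diagram.induce (support β)).Connected := by
  obtain ⟨w, i, h⟩ := hβ.1
  refine connected_support_of_geomRep_nonpos cs hβ.1 hβ.2 (w := cs.simple i * w⁻¹) ?_
  rw [h, ← geomRep_mul_apply, inv_mul_cancel_right, geomRep_simple,
    simpleReflection_simpleRoot_self]
  exact Left.neg_nonpos_iff.2 (simpleRoot_nonneg i)

lemma exists_posRoot_support_eq_insert {β : B → ℝ} (hβ : β ∈ cs.posRoots) {j : B} (hj : β j = 0)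
    (hadj : ∃ i ∈ support β, M.diagram.Adj i j) :
    ∃ γ ∈ cs.posRoots, support γ = insert j (support β) := by
  have hpos := simpleReflection_apply_self_pos M hβ.2 hj hadj
  refine ⟨M.simpleReflection j β, ⟨simpleReflection_mem_roots cs j hβ.1, fun k => ?_⟩,
    support_simpleReflection M hpos.ne'⟩
  obtain rfl | hk := eq_or_ne k j
  · exact hpos.le
  · exact (hβ.2 k).trans_eq (simpleReflection_apply_of_ne M hk β).symm

theorem exists_posRoot_support_eq {J : Set B} (hJ : (M.diagram.induce J).Connected) :
    ∃ β ∈ cs.posRoots, support β = J := by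
  obtain ⟨a, ha⟩ := nonempty_of_connected hJ
  have hsimple : support (simpleRoot a) ⊆ J := fun i hi => by
    by_contra hiJ
    exact hi (simpleRoot_of_ne fun h => hiJ (h ▸ ha))
  obtain ⟨K, ⟨hKJ, β, hβ, rfl⟩, hmax⟩ := (toFinite {K | K ⊆ J ∧ ∃ β ∈ cs.posRoots,
    support β = K}).exists_maximal ⟨_, hsimple, _, simpleRoot_mem_posRoots cs a, rfl⟩
  refine ⟨β, hβ, hKJ.antisymm ?_⟩
  by_contra hcon
  have hne : (J ∩ support β).Nonempty := by
    rw [inter_eq_right.2 hKJ, support_nonempty_iff]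
    exact ne_zero_of_mem_roots cs hβ.1
  obtain ⟨i, hi, j, hj, hadj⟩ := exists_adj_of_not_subset hJ hne hcon
  obtain ⟨γ, hγ, hsupp⟩ :=
    exists_posRoot_support_eq_insert cs hβ (notMem_support.1 hj.2) ⟨i, hi.2, hadj⟩
  exact hj.2 (hmax ⟨insert_subset hj.1 hKJ, γ, hγ, hsupp⟩ (subset_insert _ _) (mem_insert _ _))

end Roots

end Bergman

/-! ### Bases of the matroid of a flag -/

namespace Bergman

open Set

section Flag

variable {α : Type*} {M : Matroid α} {𝓕 : Set (Set α)} {B : Set α}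

lemma isBase_iff_indep_spanning : M.IsBase B ↔ M.Indep B ∧ M.Spanning B :=
  ⟨fun h => ⟨h.indep, h.spanning⟩, fun h => h.1.isBase_of_spanning h.2⟩

lemma isBase_contract_iff {X I : Set α} (hI : M.IsBasis I X) :
    (M.contract X).IsBase B ↔ M.IsBase (B ∪ I) ∧ Disjoint B X := by
  have hspan : M.Spanning (B ∪ X) ↔ M.Spanning (B ∪ I) := by
    rw [Matroid.spanning_iff, Matroid.spanning_iff, union_subset_iff, union_subset_iff,
      Matroid.closure_union_congr_right hI.closure_eq_closure,
      iff_true_intro hI.subset_ground, iff_true_intro hI.indep.subset_ground]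
  rw [isBase_iff_indep_spanning, isBase_iff_indep_spanning, hI.contract_indep_iff,
    Matroid.contract_spanning_iff hI.subset_ground, hspan, disjoint_comm]
  tauto

lemma pred_eq_empty_or_mem (hfin : 𝓕.Finite) (hchain : IsChain (· ⊆ ·) 𝓕) (F : Set α) :
    pred 𝓕 F = ∅ ∨ (pred 𝓕 F ∈ 𝓕 ∧ pred 𝓕 F ⊂ F) :=
  GraphAssoc.sUnion_eq_empty_or_mem (hfin.subset (sep_subset _ _))
    (hchain.mono (sep_subset _ _))

lemma pred_subset (𝓕 : Set (Set α)) (F : Set α) : pred 𝓕 F ⊆ F :=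
  sUnion_subset fun _ hG => hG.2.subset

lemma exists_mem_sdiff_pred (hfin : 𝓕.Finite) {x : α} (hx : x ∈ M.E) :
    ∃ F ∈ insert M.E 𝓕, x ∈ F \ pred 𝓕 F := by
  obtain ⟨F, ⟨hF, hxF⟩, hmin⟩ := ((hfin.insert M.E).subset
    (sep_subset (insert M.E 𝓕) (x ∈ ·))).exists_minimal ⟨M.E, mem_insert _ _, hx⟩
  refine ⟨F, hF, hxF, ?_⟩
  rintro ⟨G, ⟨hG, hGF⟩, hxG⟩
  exact hGF.2 (hmin ⟨mem_insert_of_mem _ hG, hxG⟩ hGF.subset)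

lemma flagMatroid_ground (hfin : 𝓕.Finite) (hsub : ∀ F ∈ 𝓕, F ⊆ M.E)
    (hchain : IsChain (· ⊆ ·) 𝓕) : (flagMatroid M 𝓕 hsub hchain).E = M.E := by
  refine Matroid.disjointSigma_ground_eq.trans (Subset.antisymm (iUnion_subset ?_) fun x hx => ?_)
  · rintro ⟨F, rfl | hF⟩ x hx
    · exact hx.1
    · exact hsub F hF hx.1
  · obtain ⟨F, hF, hxF⟩ := exists_mem_sdiff_pred hfin hx
    exact mem_iUnion.2 ⟨⟨F, hF⟩, hxF⟩

lemma isBase_restrict_contract_pred_iff {F : Set α} (hF : F ⊆ M.E)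
    (hB : M.IsBasis (B ∩ pred 𝓕 F) (pred 𝓕 F)) :
    ((M.restrict F).contract (pred 𝓕 F)).IsBase (B ∩ (F \ pred 𝓕 F)) ↔ M.IsBasis (B ∩ F) F := by
  have hB' : (M.restrict F).IsBasis (B ∩ pred 𝓕 F) (pred 𝓕 F) :=
    (Matroid.isBasis_restrict_iff hF).2 ⟨hB, pred_subset 𝓕 F⟩
  rw [isBase_contract_iff hB', Matroid.isBase_restrict_iff hF, ← inter_union_distrib_left,
    sdiff_union_of_subset (pred_subset 𝓕 F)]
  exact and_iff_left (disjoint_sdiff_left.mono_left inter_subset_right)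

lemma isBasis_inter_pred (hfin : 𝓕.Finite) (hchain : IsChain (· ⊆ ·) 𝓕) {F : Set α}
    (h : ∀ G ∈ 𝓕, G ⊂ F → M.IsBasis (B ∩ G) G) : M.IsBasis (B ∩ pred 𝓕 F) (pred 𝓕 F) := by
  rcases pred_eq_empty_or_mem hfin hchain F with h0 | ⟨hmem, hss⟩
  · rw [h0, inter_empty, Matroid.isBasis_empty_iff]
  · exact h _ hmem hss

lemma isBasis_inter_of_isBase_restrict_contract_pred (hfin : 𝓕.Finite)
    (hsub : ∀ F ∈ 𝓕, F ⊆ M.E) (hchain : IsChain (· ⊆ ·) 𝓕)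
    (hB : ∀ F ∈ insert M.E 𝓕,
      ((M.restrict F).contract (pred 𝓕 F)).IsBase (B ∩ (F \ pred 𝓕 F)))
    {F : Set α} (hF : F ∈ insert M.E 𝓕) : M.IsBasis (B ∩ F) F := by
  refine (hfin.insert M.E).wellFoundedOn (r := (· ⊂ ·)).induction
    (P := fun F => M.IsBasis (B ∩ F) F) hF fun F hF ih => ?_
  have hFE : F ⊆ M.E := by
    obtain rfl | hF := hF
    exacts [Subset.rfl, hsub F hF]
  exact (isBase_restrict_contract_pred_iff hFE (isBasis_inter_pred hfin hchain
    fun G hG hGF => ih G (mem_insert_of_mem _ hG) hGF)).1 (hB F hF)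

lemma flagMatroid_isBase_iff (hfin : 𝓕.Finite) (hsub : ∀ F ∈ 𝓕, F ⊆ M.E)
    (hchain : IsChain (· ⊆ ·) 𝓕) :
    (flagMatroid M 𝓕 hsub hchain).IsBase B ↔
      B ⊆ M.E ∧ ∀ F ∈ insert M.E 𝓕, M.IsBasis (B ∩ F) F := by
  have hground : (⋃ F : (insert M.E 𝓕 : Set (Set α)),
      ((M.restrict F.1).contract (pred 𝓕 F.1)).E) = M.E :=
    Matroid.disjointSigma_ground_eq.symm.trans (flagMatroid_ground hfin hsub hchain)
  refine Matroid.disjointSigma_isBase_iff.trans ?_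
  rw [hground, and_comm]
  refine and_congr_right fun _ => ⟨fun h F hF =>
    isBasis_inter_of_isBase_restrict_contract_pred hfin hsub hchain (fun F hF => h ⟨F, hF⟩) hF,
    fun h F => ?_⟩
  exact (isBase_restrict_contract_pred_iff (h F F.2).subset_ground (isBasis_inter_pred hfin hchain
    fun G hG _ => h G (mem_insert_of_mem _ hG))).2 (h F F.2)

end Flag

lemma linearMatroid_isBasis_iff {V : Type*} [AddCommGroup V] [Module ℝ V] {E I X : Set V}
    (hX : X ⊆ E) : (linearMatroid E).IsBasis I X ↔
      I ⊆ X ∧ LinearIndepOn ℝ id I ∧ X ⊆ Submodule.span ℝ I := by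
  constructor
  · intro h
    obtain ⟨hIE, hI⟩ : I ⊆ E ∧ LinearIndepOn ℝ id I := h.indep
    refine ⟨h.subset, hI, fun x hx => ?_⟩
    by_contra hxI
    exact hxI (Submodule.subset_span
      (h.mem_of_insert_indep hx ⟨insert_subset (hX hx) hIE, hI.id_insert hxI⟩))
  · rintro ⟨hIX, hI, hspan⟩
    refine (Matroid.isBasis_iff hX).2 ⟨⟨hIX.trans hX, hI⟩, hIX,
      fun J hJ hIJ hJX => hIJ.antisymm fun x hx => ?_⟩
    by_contra hxI
    exact ((linearIndepOn_id_insert hxI).1 (hJ.2.mono (insert_subset hx hIJ))).2 (hspan (hJX hx))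

end Bergman

/-! ### Positive flats -/

namespace Bergman

open Set Function CoxeterMatrix CoxeterSystem GraphAssoc

section SimpleRoots

variable {B : Type*}

lemma mem_spanSubset_iff_support_subset [Finite B] {J : Set B} {v : B → ℝ} :
    v ∈ Pi.spanSubset ℝ J ↔ support v ⊆ J := by
  rw [Pi.mem_spanSubset_iff, support_subset_iff']

variable [DecidableEq B]

lemma dual_apply_eq_sum [Fintype B] (f : Module.Dual ℝ (B → ℝ)) (v : B → ℝ) :
    f v = ∑ i, v i * f (simpleRoot i) := by
  conv_lhs => rw [pi_eq_sum_univ' v]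
  simp only [map_sum, map_smul, smul_eq_mul, simpleRoot]

variable [Finite B]

lemma span_image_simpleRoot (J : Set B) :
    Submodule.span ℝ (simpleRoot '' J) = Pi.spanSubset ℝ J := by
  rw [Pi.spanSubset]
  congr! with i
  exact funext fun i => (Pi.basisFun_apply ℝ B i).symm

lemma simpleRoot_mem_of_ne_zero {S : Submodule ℝ (B → ℝ)} {v : B → ℝ} (hv : v ∈ S) {j : B}
    (hj : v j ≠ 0) (h : ∀ i ∈ support v, i ≠ j → simpleRoot i ∈ S) : simpleRoot j ∈ S := by
  have := Fintype.ofFinite B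
  have hsum : v = v j • simpleRoot j + ∑ i ∈ Finset.univ.erase j, v i • simpleRoot i := by
    rw [Finset.add_sum_erase _ (fun i => v i • simpleRoot i) (Finset.mem_univ j)]
    exact pi_eq_sum_univ' v
  have hmem : ∑ i ∈ Finset.univ.erase j, v i • simpleRoot i ∈ S := by
    refine S.sum_mem fun i hi => ?_
    by_cases hvi : v i = 0
    · rw [hvi, zero_smul]
      exact S.zero_mem
    · exact S.smul_mem _ (h i hvi (Finset.ne_of_mem_erase hi))
  rw [hsum, S.add_mem_iff_left hmem] at hv
  exact (S.smul_mem_iff hj).1 hv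

lemma linearIndepOn_insert_simpleRoot {β : B → ℝ} {j : B} (hj : β j ≠ 0) :
    LinearIndepOn ℝ id (insert β (simpleRoot '' {j}ᶜ)) := by
  have hind : LinearIndependent ℝ (simpleRoot : B → B → ℝ) := Pi.linearIndependent_single_one B ℝ
  refine (hind.linearIndepOn_id.mono (image_subset_range _ _)).id_insert fun h => hj ?_
  rw [span_image_simpleRoot] at h
  exact Pi.mem_spanSubset_iff.1 h j (notMem_compl_iff.2 rfl)

end SimpleRoots

section ParabolicRoots

variable {B : Type*} [Fintype B] [DecidableEq B] {M : CoxeterMatrix B} {W : Type*} [Group W]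
  (cs : CoxeterSystem M W)

/-- The positive roots of the standard parabolic subgroup generated by `J`. -/
def parabolicRoots (J : Set B) : Set (B → ℝ) := {a ∈ cs.posRoots | support a ⊆ J}

variable {J K : Set B}

lemma simpleRoot_mem_parabolicRoots_iff {i : B} : simpleRoot i ∈ parabolicRoots cs J ↔ i ∈ J := by
  have hsupp : support (simpleRoot i) = {i} := Pi.support_single_of_ne one_ne_zero
  rw [parabolicRoots, mem_sep_iff, hsupp, singleton_subset_iff]
  exact and_iff_right (simpleRoot_mem_posRoots cs i)

lemma parabolicRoots_subset_iff : parabolicRoots cs J ⊆ parabolicRoots cs K ↔ J ⊆ K :=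
  ⟨fun h _ hi => (simpleRoot_mem_parabolicRoots_iff cs).1
    (h ((simpleRoot_mem_parabolicRoots_iff cs).2 hi)), fun h _ ha => ⟨ha.1, ha.2.trans h⟩⟩

lemma parabolicRoots_injective : Injective (parabolicRoots cs) := fun _ _ h =>
  ((parabolicRoots_subset_iff cs).1 h.le).antisymm ((parabolicRoots_subset_iff cs).1 h.ge)

lemma parabolicRoots_empty : parabolicRoots cs ∅ = ∅ :=
  eq_empty_of_forall_notMem fun _ ha =>
    ne_zero_of_mem_roots cs ha.1.1 (support_eq_empty_iff.1 (subset_empty_iff.1 ha.2))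

lemma parabolicRoots_univ : parabolicRoots cs univ = cs.posRoots :=
  sep_eq_self_iff_mem_true.2 fun _ _ => subset_univ _

lemma span_parabolicRoots (J : Set B) :
    Submodule.span ℝ (parabolicRoots cs J) = Pi.spanSubset ℝ J := by
  refine le_antisymm (Submodule.span_le.2 fun a ha =>
    mem_spanSubset_iff_support_subset.2 ha.2) ?_
  rw [← span_image_simpleRoot]
  exact Submodule.span_mono
    (image_subset_iff.2 fun _ hi => (simpleRoot_mem_parabolicRoots_iff cs).2 hi)

lemma isFlat_parabolicRoots (J : Set B) : cs.rootMatroid.IsFlat (parabolicRoots cs J) := by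
  refine ⟨fun I X hI hX => ?_, fun a ha => ha.1⟩
  have hXE : X ⊆ cs.posRoots := hX.subset_ground
  have hspan : X ⊆ Submodule.span ℝ I := ((linearMatroid_isBasis_iff hXE).1 hX).2.2
  have hle : Submodule.span ℝ I ≤ Pi.spanSubset ℝ J := by
    rw [← span_parabolicRoots cs]
    exact Submodule.span_mono hI.subset
  exact fun x hx => ⟨hXE hx, mem_spanSubset_iff_support_subset.1 (hle (hspan hx))⟩

lemma mem_titsCone_of_nonneg {f : Module.Dual ℝ (B → ℝ)} (hf : ∀ i, 0 ≤ f (simpleRoot i)) :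
    f ∈ cs.titsCone :=
  ⟨1, fun i => by simpa only [map_one, LinearEquiv.coe_one, id_eq] using hf i⟩

lemma isParabolicFlat_parabolicRoots (J : Set B) : cs.IsParabolicFlat (parabolicRoots cs J) := by
  refine ⟨isFlat_parabolicRoots cs J,
    (Submodule.span_le.2 inter_subset_left).antisymm fun f hf => ?_⟩
  rw [span_parabolicRoots] at hf ⊢
  have hfJ : ∀ i ∈ J, f (simpleRoot i) = 0 := fun i hi =>
    (Submodule.mem_dualAnnihilator _).1 hf _ (span_image_simpleRoot J ▸
      Submodule.subset_span (mem_image_of_mem _ hi))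
  have hsum : f = ∑ i, f (simpleRoot i) • (LinearMap.proj i : Module.Dual ℝ (B → ℝ)) := by
    refine LinearMap.ext fun v => ?_
    simp only [dual_apply_eq_sum f v, LinearMap.sum_apply, LinearMap.smul_apply,
      LinearMap.proj_apply, smul_eq_mul, mul_comm]
  rw [hsum]
  refine Submodule.sum_mem _ fun i _ => ?_
  by_cases hi : i ∈ J
  · rw [hfJ i hi, zero_smul]
    exact Submodule.zero_mem _
  · refine Submodule.smul_mem _ _ (Submodule.subset_span ⟨?_, ?_⟩)
    · exact (Submodule.mem_dualAnnihilator _).2 fun v hv => Pi.mem_spanSubset_iff.1 hv i hi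
    · exact mem_titsCone_of_nonneg cs fun j => simpleRoot_nonneg j i

lemma setOf_dual_apply_eq_zero {f : Module.Dual ℝ (B → ℝ)} (hf : ∀ i, 0 ≤ f (simpleRoot i)) :
    {a ∈ cs.posRoots | f a = 0} = parabolicRoots cs {i | f (simpleRoot i) = 0} := by
  refine sep_ext_iff.2 fun a ha => ?_
  rw [dual_apply_eq_sum, Finset.sum_eq_zero_iff_of_nonneg fun i _ => mul_nonneg (ha.2 i) (hf i)]
  simp only [Finset.mem_univ, forall_const, mul_eq_zero, or_iff_not_imp_left, support_subset_iff,
    mem_ofPred_eq, ne_eq]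

lemma isPositiveFlat_parabolicRoots (J : Set B) : cs.IsPositiveFlat (parabolicRoots cs J) := by
  classical
  let f : Module.Dual ℝ (B → ℝ) := (Pi.basisFun ℝ B).constr ℝ (Jᶜ.indicator 1)
  have hf (i : B) : f (simpleRoot i) = Jᶜ.indicator 1 i := by
    rw [← (Pi.basisFun ℝ B).constr_basis ℝ (Jᶜ.indicator 1 : B → ℝ) i, Pi.basisFun_apply]
    rfl
  have hf0 (i : B) : 0 ≤ f (simpleRoot i) := by
    rw [hf]
    exact indicator_nonneg (fun _ _ => zero_le_one) i
  refine ⟨isParabolicFlat_parabolicRoots cs J, f, fun a ha => ?_, ?_⟩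
  · rw [dual_apply_eq_sum]
    exact Finset.sum_nonneg fun i _ => mul_nonneg (ha.2 i) (hf0 i)
  · rw [setOf_dual_apply_eq_zero cs hf0]
    congr 1
    ext i
    simp [hf]

lemma exists_eq_parabolicRoots {F : Set (B → ℝ)} (hF : cs.IsPositiveFlat F) :
    ∃ J, F = parabolicRoots cs J := by
  obtain ⟨-, f, hf, rfl⟩ := hF
  exact ⟨_, setOf_dual_apply_eq_zero cs fun i => hf _ (simpleRoot_mem_posRoots cs i)⟩

/-! ### Flags of positive flats as chains of subsets of the diagram -/

variable {cs}

/-- The flag of subsets of the diagram that corresponds to a flag of positive flats. -/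
def sets (𝓕 : cs.PosFlag) : Set (Set B) := parabolicRoots cs ⁻¹' 𝓕.carrier

lemma image_sets (𝓕 : cs.PosFlag) : parabolicRoots cs '' sets 𝓕 = 𝓕.carrier :=
  image_preimage_eq_of_subset fun F hF => by
    obtain ⟨J, rfl⟩ := exists_eq_parabolicRoots cs (𝓕.positive F hF)
    exact mem_range_self J

lemma isChain_insert_univ_sets (𝓕 : cs.PosFlag) : IsChain (· ⊆ ·) (insert univ (sets 𝓕)) := by
  refine IsChain.insert (fun J hJ K hK hne => ?_) fun _ _ _ => .inr (subset_univ _)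
  simpa only [parabolicRoots_subset_iff] using
    𝓕.chain hJ hK ((parabolicRoots_injective cs).ne hne)

lemma nonempty_of_mem_sets {𝓕 : cs.PosFlag} (hJ : J ∈ sets 𝓕) : J.Nonempty := by
  rw [nonempty_iff_ne_empty]
  rintro rfl
  exact 𝓕.ne_empty _ hJ (parabolicRoots_empty cs)

lemma univ_notMem_sets (𝓕 : cs.PosFlag) : univ ∉ sets 𝓕 := fun h =>
  𝓕.ne_ground _ h (parabolicRoots_univ cs)

variable (cs) in
/-- The flag of positive flats that corresponds to a flag of subsets of the diagram. -/
def ofSets (𝓒 : Set (Set B)) (hchain : IsChain (· ⊆ ·) 𝓒) (hempty : ∅ ∉ 𝓒) (huniv : univ ∉ 𝓒) :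
    cs.PosFlag where
  carrier := parabolicRoots cs '' 𝓒
  finite := (toFinite 𝓒).image _
  positive := forall_mem_image.2 fun J _ => isPositiveFlat_parabolicRoots cs J
  ne_empty := forall_mem_image.2 fun _ hJ h => hempty <|
    parabolicRoots_injective cs (h.trans (parabolicRoots_empty cs).symm) ▸ hJ
  ne_ground := forall_mem_image.2 fun _ hJ h => huniv <|
    parabolicRoots_injective cs (h.trans (parabolicRoots_univ cs).symm) ▸ hJ
  chain := hchain.image_of_map_rel _ _ (parabolicRoots cs) fun _ _ h =>
    (parabolicRoots_subset_iff cs).2 h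

lemma sets_ofSets (𝓒 : Set (Set B)) (hchain : IsChain (· ⊆ ·) 𝓒) (hempty : ∅ ∉ 𝓒)
    (huniv : univ ∉ 𝓒) : sets (ofSets cs 𝓒 hchain hempty huniv) = 𝓒 :=
  (parabolicRoots_injective cs).preimage_image 𝓒

/-! ### Bases of the matroid of a flag of positive flats -/

variable (cs) {I : Set (B → ℝ)}

/-- The positive roots with support in `J` that belong to `I` span all vectors with support in
`J`. The bases of the matroid of a flag are characterized by this condition. -/
def SpansParabolic (I : Set (B → ℝ)) (J : Set B) : Prop :=
  Pi.spanSubset ℝ J ≤ Submodule.span ℝ (I ∩ parabolicRoots cs J)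

lemma spansParabolic_iff_simpleRoot_mem : SpansParabolic cs I J ↔
    ∀ j ∈ J, simpleRoot j ∈ Submodule.span ℝ (I ∩ parabolicRoots cs J) := by
  rw [SpansParabolic, ← span_image_simpleRoot, Submodule.span_le, image_subset_iff]
  rfl

lemma isBasis_inter_parabolicRoots_iff : cs.rootMatroid.IsBasis (I ∩ parabolicRoots cs J)
    (parabolicRoots cs J) ↔ LinearIndepOn ℝ id (I ∩ parabolicRoots cs J) ∧
      SpansParabolic cs I J := by
  rw [rootMatroid, linearMatroid_isBasis_iff fun a ha => ha.1, SpansParabolic,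
    ← span_parabolicRoots cs, Submodule.span_le]
  exact and_iff_right inter_subset_right

lemma span_inter_parabolicRoots_le (I : Set (B → ℝ)) (J : Set B) :
    Submodule.span ℝ (I ∩ parabolicRoots cs J) ≤ Pi.spanSubset ℝ J := by
  rw [← span_parabolicRoots cs]
  exact Submodule.span_mono inter_subset_right

lemma parabolicRoots_eq_union {C : Set B} (hC : IsComponent M.diagram J C) :
    parabolicRoots cs J = parabolicRoots cs C ∪ parabolicRoots cs (J \ C) := by
  refine Subset.antisymm (fun a ha => ?_) (union_subset
    ((parabolicRoots_subset_iff cs).2 hC.subset) ((parabolicRoots_subset_iff cs).2 sdiff_subset))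
  by_cases hne : (C ∩ support a).Nonempty
  · exact .inl ⟨ha.1,
      hC.subset_of_inter_nonempty (connected_support_of_mem_posRoots cs ha.1) ha.2 hne⟩
  · exact .inr ⟨ha.1, subset_sdiff.2
      ⟨ha.2, disjoint_iff_inter_eq_empty.2 (inter_comm _ _ ▸ not_nonempty_iff_eq_empty.1 hne)⟩⟩

variable {cs} in
lemma SpansParabolic.of_isComponent {C : Set B} (h : SpansParabolic cs I J)
    (hC : IsComponent M.diagram J C) : SpansParabolic cs I C := by
  intro v hv
  have hvJ : v ∈ Pi.spanSubset ℝ J :=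
    mem_spanSubset_iff_support_subset.2 ((mem_spanSubset_iff_support_subset.1 hv).trans hC.subset)
  have hsup := h hvJ
  rw [parabolicRoots_eq_union cs hC, inter_union_distrib_left, Submodule.span_union,
    Submodule.mem_sup] at hsup
  obtain ⟨x, hx, y, hy, rfl⟩ := hsup
  have hyC : y ∈ Pi.spanSubset ℝ C :=
    ((Pi.spanSubset ℝ C).add_mem_iff_right (span_inter_parabolicRoots_le cs I C hx)).1 hv
  have hyJC : y ∈ Pi.spanSubset ℝ (J \ C) := span_inter_parabolicRoots_le cs I _ hy
  have hy0 : y = 0 := by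
    rw [mem_spanSubset_iff_support_subset] at hyC hyJC
    exact support_eq_empty_iff.1 (disjoint_self.1 (disjoint_sdiff_right.mono hyC hyJC))
  rwa [hy0, add_zero]

lemma spansParabolic_iff_forall_isComponent :
    SpansParabolic cs I J ↔ ∀ C, IsComponent M.diagram J C → SpansParabolic cs I C := by
  refine ⟨fun h C hC => h.of_isComponent hC, fun h => ?_⟩
  refine (spansParabolic_iff_simpleRoot_mem cs).2 fun j hj => ?_
  obtain ⟨C, hC, hjC⟩ := exists_isComponent_mem (G := M.diagram) hj
  exact Submodule.span_mono (inter_subset_inter_right _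
    ((parabolicRoots_subset_iff cs).2 hC.subset))
    ((spansParabolic_iff_simpleRoot_mem cs).1 (h C hC) j hjC)

lemma spansParabolic_insert_simpleRoot_iff {β : B → ℝ} (hβ : β ∈ cs.posRoots) {j : B}
    (hj : β j ≠ 0) :
    SpansParabolic cs (insert β (simpleRoot '' {j}ᶜ)) J ↔ (j ∈ J → support β ⊆ J) := by
  rw [spansParabolic_iff_simpleRoot_mem]
  constructor
  · intro h hjJ
    by_contra hβJ
    have hsub : insert β (simpleRoot '' {j}ᶜ) ∩ parabolicRoots cs J ⊆ simpleRoot '' {j}ᶜ := by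
      rintro a ⟨rfl | ha, haJ⟩
      · exact absurd haJ.2 hβJ
      · exact ha
    have hmem := Submodule.span_mono hsub (h j hjJ)
    rw [span_image_simpleRoot, Pi.mem_spanSubset_iff] at hmem
    exact one_ne_zero ((simpleRoot_self j).symm.trans (hmem j (notMem_compl_iff.2 rfl)))
  · intro h i hi
    have hne : ∀ k ∈ J, k ≠ j → simpleRoot k ∈ Submodule.span ℝ
        (insert β (simpleRoot '' {j}ᶜ) ∩ parabolicRoots cs J) := fun k hk hkj =>
      Submodule.subset_span
        ⟨.inr (mem_image_of_mem _ hkj), (simpleRoot_mem_parabolicRoots_iff cs).2 hk⟩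
    by_cases hij : i = j
    · subst hij
      have hβI : β ∈ insert β (simpleRoot '' {i}ᶜ) ∩ parabolicRoots cs J :=
        ⟨mem_insert _ _, hβ, h hi⟩
      exact simpleRoot_mem_of_ne_zero (Submodule.subset_span hβI) hj fun k hk => hne k (h hi hk)
    · exact hne i hi hij

end ParabolicRoots

/-! ### The tubing of a flag of positive flats -/

section Tubing

variable {B : Type*} [Fintype B] [DecidableEq B] {M : CoxeterMatrix B} {W : Type*} [Group W]
  {cs : CoxeterSystem M W}

lemma matroid_isBase_iff (𝓕 : cs.PosFlag) (I : Set (B → ℝ)) :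
    𝓕.matroid.IsBase I ↔ I ⊆ cs.posRoots ∧ LinearIndepOn ℝ id I ∧
      ∀ J ∈ insert univ (sets 𝓕), SpansParabolic cs I J := by
  have hE : cs.rootMatroid.E = parabolicRoots cs univ := (parabolicRoots_univ cs).symm
  rw [PosFlag.matroid, flagMatroid_isBase_iff 𝓕.finite, hE, ← image_sets, ← image_insert_eq,
    forall_mem_image, parabolicRoots_univ]
  simp only [isBasis_inter_parabolicRoots_iff]
  refine and_congr_right fun hI => ⟨fun h => ⟨?_, fun J hJ => (h hJ).2⟩, fun h J hJ =>
    ⟨h.1.mono inter_subset_left, h.2 J hJ⟩⟩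
  simpa only [parabolicRoots_univ, inter_eq_left.2 hI] using (h (mem_insert _ _)).1

/-- The components of the members of a flag, including those of the whole diagram. -/
def tubes (𝓕 : cs.PosFlag) : Set (Set B) := comps M.diagram (insert univ (sets 𝓕))

lemma connected_of_mem_tubes {𝓕 : cs.PosFlag} {t : Set B} (ht : t ∈ tubes 𝓕) :
    (M.diagram.induce t).Connected :=
  ht.elim fun _ h => h.2.connected

lemma matroid_isBase_iff_forall_tubes (𝓕 : cs.PosFlag) (I : Set (B → ℝ)) :
    𝓕.matroid.IsBase I ↔ I ⊆ cs.posRoots ∧ LinearIndepOn ℝ id I ∧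
      ∀ t ∈ tubes 𝓕, SpansParabolic cs I t := by
  rw [matroid_isBase_iff]
  refine and_congr_right fun _ => and_congr_right fun _ => ⟨?_, fun h J hJ =>
    (spansParabolic_iff_forall_isComponent cs).2 fun C hC => h C ⟨J, hJ, hC⟩⟩
  rintro h C ⟨J, hJ, hC⟩
  exact (h J hJ).of_isComponent hC

lemma exists_isBase_not_spansParabolic (𝓕 : cs.PosFlag) {t : Set B}
    (ht : (M.diagram.induce t).Connected) (htF : t ∉ tubes 𝓕) :
    ∃ I, 𝓕.matroid.IsBase I ∧ ¬ SpansParabolic cs I t := by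
  obtain ⟨C, hC, htC, j, hjt, hj⟩ := exists_connected_ssuperset_of_notMem_comps
    (toFinite _) (isChain_insert_univ_sets 𝓕) (mem_insert _ _) ht htF
  obtain ⟨β, hβ, rfl⟩ := exists_posRoot_support_eq cs hC
  have hβj : β j ≠ 0 := htC.subset hjt
  refine ⟨insert β (simpleRoot '' {j}ᶜ), (matroid_isBase_iff 𝓕 _).2
    ⟨insert_subset hβ (image_subset_iff.2 fun i _ => simpleRoot_mem_posRoots cs i),
      linearIndepOn_insert_simpleRoot hβj, fun J hJ => ?_⟩, fun h => ?_⟩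
  · exact (spansParabolic_insert_simpleRoot_iff cs hβ hβj).2 (hj J hJ)
  · exact htC.not_subset ((spansParabolic_insert_simpleRoot_iff cs hβ hβj).1 h hjt)

lemma tubes_subset_of_matroid_eq {𝓕 𝓖 : cs.PosFlag} (h : 𝓕.matroid = 𝓖.matroid) :
    tubes 𝓕 ⊆ tubes 𝓖 := by
  intro t ht
  by_contra ht𝓖
  obtain ⟨I, hI, hIt⟩ := exists_isBase_not_spansParabolic 𝓖 (connected_of_mem_tubes ht) ht𝓖
  rw [← h, matroid_isBase_iff_forall_tubes] at hI
  exact hIt (hI.2.2 t ht)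

theorem matroid_eq_iff_tubes_eq (𝓕 𝓖 : cs.PosFlag) :
    𝓕.matroid = 𝓖.matroid ↔ tubes 𝓕 = tubes 𝓖 := by
  refine ⟨fun h => (tubes_subset_of_matroid_eq h).antisymm (tubes_subset_of_matroid_eq h.symm),
    fun h => Matroid.ext_isBase ?_ fun I _ => ?_⟩
  · rw [PosFlag.matroid, PosFlag.matroid, flagMatroid_ground 𝓕.finite,
      flagMatroid_ground 𝓖.finite]
  · rw [matroid_isBase_iff_forall_tubes, matroid_isBase_iff_forall_tubes, h]

/-- The tubing of the diagram associated to a flag of positive flats: the components of the members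
of the flag that are not components of the diagram. -/
def tubing (𝓕 : cs.PosFlag) : GeneralTubing M.diagram :=
  ⟨tubes 𝓕 \ {t | IsComponent M.diagram univ t}, fun _ ht => ⟨connected_of_mem_tubes ht.1, ht.2⟩,
    fun _ ht _ hu _ => compat_of_mem_comps (isChain_insert_univ_sets 𝓕) ht.1 hu.1⟩

lemma tubing_val (𝓕 : cs.PosFlag) :
    (tubing 𝓕).1 = tubes 𝓕 \ {t | IsComponent M.diagram univ t} :=
  rfl

lemma tubes_eq_tubing_union (𝓕 : cs.PosFlag) :
    tubes 𝓕 = (tubing 𝓕).1 ∪ {t | IsComponent M.diagram univ t} := by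
  rw [tubing_val, sdiff_union_of_subset]
  exact fun t ht => ⟨univ, mem_insert _ _, ht⟩

lemma tubing_le_tubing_of_carrier_subset {𝓕 𝓖 : cs.PosFlag} (h : 𝓕.carrier ⊆ 𝓖.carrier) :
    tubing 𝓕 ≤ tubing 𝓖 :=
  sdiff_subset_sdiff_left (comps_mono (insert_subset_insert (preimage_mono h)))

lemma exists_carrier_superset_tubing_eq (𝓕 : cs.PosFlag) {T : GeneralTubing M.diagram}
    (h : tubing 𝓕 ≤ T) : ∃ 𝓖 : cs.PosFlag, tubing 𝓖 = T ∧ 𝓕.carrier ⊆ 𝓖.carrier := by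
  have hconn : ∀ t ∈ T.1 ∪ {t | IsComponent M.diagram univ t}, (M.diagram.induce t).Connected :=
    fun t ht => ht.elim (fun h => (T.2.1 t h).1) IsComponent.connected
  obtain ⟨𝓓, hsub, hchain, hne, hcomps⟩ := exists_isChain_comps_eq hconn T.pairwise_compat_union
    (isChain_insert_univ_sets 𝓕)
    ((tubes_eq_tubing_union 𝓕).subset.trans (union_subset_union_left _ h))
  have hinsert : insert univ (𝓓 \ {univ}) = 𝓓 :=
    insert_sdiff_self_of_mem (hsub (mem_insert _ _))
  have hempty : ∅ ∉ 𝓓 \ {univ} := fun h => not_nonempty_empty <|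
    (hne ∅ h.1).elim (fun h' => nonempty_of_mem_sets (h'.resolve_left h.2)) id
  have huniv : univ ∉ 𝓓 \ {univ} := fun h => h.2 rfl
  refine ⟨ofSets cs (𝓓 \ {univ}) (hchain.mono sdiff_subset) hempty huniv, Subtype.ext ?_, ?_⟩
  · rw [tubing_val, tubes, sets_ofSets, hinsert, hcomps, union_sdiff_right, sdiff_eq_left]
    exact disjoint_left.2 fun t ht => (T.2.1 t ht).2
  · rw [← image_sets 𝓕]
    refine image_mono fun J hJ => ⟨hsub (mem_insert_of_mem _ hJ), ?_⟩
    rintro rfl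
    exact univ_notMem_sets 𝓕 hJ

lemma tubing_eq_iff_matroid_eq (𝓕 𝓖 : cs.PosFlag) :
    tubing 𝓕 = tubing 𝓖 ↔ 𝓕.matroid = 𝓖.matroid := by
  rw [matroid_eq_iff_tubes_eq]
  refine ⟨fun h => by rw [tubes_eq_tubing_union, tubes_eq_tubing_union, h],
    fun h => Subtype.ext ?_⟩
  rw [tubing_val, tubing_val, h]

lemma coarseCell_eq_iff (𝓕 𝓖 : cs.PosFlag) :
    cs.coarseCell 𝓕 = cs.coarseCell 𝓖 ↔ tubing 𝓕 = tubing 𝓖 :=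
  Quotient.eq.trans (tubing_eq_iff_matroid_eq 𝓕 𝓖).symm

lemma coarseCell_le_iff (𝓕 𝓖 : cs.PosFlag) :
    cs.coarseCell 𝓕 ≤ cs.coarseCell 𝓖 ↔ tubing 𝓕 ≤ tubing 𝓖 := by
  constructor
  · intro h
    obtain ⟨𝓗, h𝓗, hsub⟩ := h 𝓕 rfl
    rw [← (coarseCell_eq_iff _ _).1 h𝓗]
    exact tubing_le_tubing_of_carrier_subset hsub
  · intro h 𝓕' h𝓕'
    rw [← (coarseCell_eq_iff _ _).1 h𝓕'] at h
    obtain ⟨𝓗, h𝓗, hsub⟩ := exists_carrier_superset_tubing_eq 𝓕' h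
    exact ⟨𝓗, (coarseCell_eq_iff _ _).2 h𝓗, hsub⟩

lemma tubing_surjective : Surjective (tubing (cs := cs)) := by
  intro T
  let 𝓔 : cs.PosFlag := ofSets cs ∅ IsChain.empty (notMem_empty _) (notMem_empty _)
  have h𝓔 : tubing 𝓔 ≤ T := by
    rintro t ⟨⟨J, hJ, ht⟩, ht'⟩
    rw [sets_ofSets, insert_empty_eq, mem_singleton_iff] at hJ
    exact absurd (hJ ▸ ht) ht'
  obtain ⟨𝓖, h𝓖, -⟩ := exists_carrier_superset_tubing_eq 𝓔 h𝓔
  exact ⟨𝓖, h𝓖⟩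

variable (cs) in
/-- The isomorphism from the face poset of the coarse subdivision to the poset of tubings, which
sends the cell of a flag to the tubing of the flag. -/
noncomputable def coarseCellOrderIso : cs.CoarseCell ≃o GeneralTubing M.diagram where
  toEquiv := Equiv.ofBijective
    (Quotient.lift tubing fun 𝓕 𝓖 => (tubing_eq_iff_matroid_eq 𝓕 𝓖).2) <| by
      refine ⟨?_, (Quot.surjective_lift _).2 tubing_surjective⟩
      rintro ⟨𝓕⟩ ⟨𝓖⟩ h
      exact (coarseCell_eq_iff 𝓕 𝓖).2 h
  map_rel_iff' := by
    rintro ⟨𝓕⟩ ⟨𝓖⟩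
    exact (coarseCell_le_iff 𝓕 𝓖).symm

end Tubing

end Bergman

theorem theorem1 {B : Type*} [Fintype B] [DecidableEq B] {M : CoxeterMatrix B}
    {W : Type*} [Group W] (cs : CoxeterSystem M W) :
    -- connected diagrams (irreducible Coxeter systems)
    (M.diagram.Connected →
      Nonempty (cs.CoarseCell ≃o GraphAssoc.Tubing M.diagram) ∧
      (∃ P : Set (B → ℝ), GraphAssoc.IsGraphAssociahedron M.diagram P) ∧
      ∀ P : Set (B → ℝ), GraphAssoc.IsGraphAssociahedron M.diagram P →
        Nonempty (cs.CoarseCell ≃o (GraphAssoc.Face P)ᵒᵈ)) ∧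
    -- arbitrary diagrams: the graph associahedron is the product over the connected components
    Nonempty (cs.CoarseCell ≃o
      ∀ C : M.diagram.ConnectedComponent, GraphAssoc.Tubing (M.diagram.induce C.supp)) ∧
    (∃ P : ∀ C : M.diagram.ConnectedComponent, Set (C.supp → ℝ),
      ∀ C, GraphAssoc.IsGraphAssociahedron (M.diagram.induce C.supp) (P C)) ∧
    ∀ P : ∀ C : M.diagram.ConnectedComponent, Set (C.supp → ℝ),
      (∀ C, GraphAssoc.IsGraphAssociahedron (M.diagram.induce C.supp) (P C)) →
      Nonempty (cs.CoarseCell ≃o (GraphAssoc.Face (Set.univ.pi P))ᵒᵈ) := by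
  let e := Bergman.coarseCellOrderIso cs
  refine ⟨fun hG => ⟨⟨e.trans (GraphAssoc.generalTubingOrderIsoTubing hG)⟩,
    GraphAssoc.exists_isGraphAssociahedron hG, fun P hP => ?_⟩,
    ⟨e.trans GraphAssoc.GeneralTubing.orderIsoPi⟩, ?_, fun P hP => ?_⟩
  · obtain ⟨f⟩ := GraphAssoc.IsGraphAssociahedron.nonempty_orderIso hG hP
    exact ⟨(e.trans (GraphAssoc.generalTubingOrderIsoTubing hG)).trans f⟩
  · choose P hP using fun C : M.diagram.ConnectedComponent =>
      GraphAssoc.exists_isGraphAssociahedron (GraphAssoc.isComponent_supp C).connected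
    exact ⟨P, hP⟩
  · have f := fun C =>
      ((hP C).nonempty_orderIso (GraphAssoc.isComponent_supp C).connected).some
    let f₁ : (∀ C : M.diagram.ConnectedComponent, GraphAssoc.Tubing (M.diagram.induce C.supp)) ≃o
        ∀ C, (GraphAssoc.Face (P C))ᵒᵈ :=
      ⟨Equiv.piCongrRight fun C => (f C).toEquiv, forall_congr' fun C => (f C).le_iff_le⟩
    exact ⟨((e.trans GraphAssoc.GeneralTubing.orderIsoPi).trans f₁).trans
      (GraphAssoc.facePiOrderIso P)⟩
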